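/- Let $\rho$ be a Borel probability measure on $\mathbb{R}$ that is not a point mass and for which $\Theta=\{\beta\in\mathbb{R}:\int e^{\beta x}\,d\rho(x)<\infty\}$ is open. For $\beta\in\Theta$ put $A(\beta)=\log\int e^{\beta x}\,d\rho(x)$. Let $\mathtt M$ be the set of means $\int x\,e^{\beta x-A(\beta)}\,d\rho(x)$, $\beta\in\Theta$, and for $\mu\in\mathtt M$ let $\lambda(\mu)\in\Theta$ be the canonical parameter with mean $\mu$, let $p_\mu(x)=e^{\lambda(\mu)x-A(\lambda(\mu))}$, and let $P_\mu$ be the distribution with density $p_\mu$ relative to $\rho$. Let $I(\mu)=\mathbb{E}_{P_\mu}[(\tfrac{d}{d\mu}\log p_\mu(X))^2]$ be the Fisher information. For $\vec\mu\in\mathtt M^k$ let $P_{\vec\mu}$ be the law of independent $X_i\sim P_{\mu_i}$, $i=1,\dots,k$, with density $p_{\vec\mu}(x^k)=\prod_i p_{\mu_i}(x_i)$ relative to the product measure $\rho^k$; let $Z=\sum_{i=1}^k X_i$, let $\rho_{[Z]}$ and $P_{\vec\mu;[Z]}$ be the laws of $Z$ under $\rho^k$ and $P_{\vec\mu}$,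 let $\rho^k(\cdot\mid Z=z)$ be the regular conditional distribution of $X^k$ given $Z=z$ under $\rho^k$, and let $$p_{\vec\mu;[Z]}(z)=\int p_{\vec\mu}(x^k)\,\rho^k(dx^k\mid Z=z).$$ Write $\langle\mu_0\rangle=(\mu_0,\dots,\mu_0)$ and $$S_{\rm pseudo}=\frac{p_{\vec\mu}(X^k)}{p_{\langle\mu_0^*\rangle}(X^k)},\quad \mu_0^*=\frac1k\sum_{i=1}^k\mu_i,\qquad S_{\rm cond}=\frac{p_{\vec\mu}(X^k)/p_{\vec\mu;[Z]}(Z)}{p_{\langle\mu_0\rangle}(X^k)/p_{\langle\mu_0\rangle;[Z]}(Z)}.$$ Fix $\mu_0\in\mathtt M$ and $\vec\alpha\in\mathbb{R}^k$ with $\sum_j\alpha_j^2=1$ and $\sum_j\alpha_j=0$. For $\delta\in\mathbb{R}$ put $\vec\mu=\langle\mu_0\rangle+\delta\vec\alpha$ and $g_z(\delta)=p_{\langle\mu_0\rangle+\delta\vec\alpha;[Z]}(z)$, and let $f(\delta)=\mathbb{E}_{P_{\vec\mu}}[\log S_{\rm pseudo}-\log S_{\rm cond}]$. Then: 1. For every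 $\delta$ with $\vec\mu\in\mathtt M^k$, $z\mapsto g_z(\delta)$ is a density of $P_{\vec\mu;[Z]}$ relative to $\rho_{[Z]}$, the expectation $f(\delta)$ is well defined and finite, and $f(\delta)=D(P_{\vec\mu;[Z]}\,\|\,P_{\langle\mu_0\rangle;[Z]})<\infty$. 2. $I$ is differentiable at $\mu_0$, and for $\rho_{[Z]}$-almost every $z$ we have $g_z(0)>0$, $g_z$ is twice continuously differentiable at $0$, $g_z'(0)=0$, and $$g_z''(0)=\int p_{\langle\mu_0\rangle}(x^k)\Big\{I(\mu_0)^2\Big(\sum_{j=1}^k\alpha_j(x_j-\mu_0)\Big)^2+\sum_{j=1}^k\alpha_j^2\big[I'(\mu_0)(x_j-\mu_0)-I(\mu_0)\big]\Big\}\,\rho^k(dx^k\mid Z=z),$$ with an absolutely convergent integral. 3. $f$ is three times continuously differentiable at $0$ with $f'(0)=f''(0)=f'''(0)=0$; the integral below is finite; and, as $\delta\to0$, $$f(\delta)=\frac18\int\frac{(g_z''(0))^2}{g_z(0)}\,d\rho_{[Z]}(z)\cdot\delta^4+o(\delta^4)=O(\delta^4).$$ -/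

import Mathlib

open MeasureTheory ProbabilityTheory InformationTheory Filter Asymptotics
open scoped Topology

noncomputable section

namespace ExpFam

/-! ### The one-dimensional natural exponential family generated by `ρ` -/

/-- The canonical parameter space: all `β` with `∫ exp (β x) dρ(x) < ∞`. -/
def canonicalSpace (ρ : Measure ℝ) : Set ℝ := integrableExpSet id ρ

/-- The log-normalizer `A(β) = log ∫ exp (β x) dρ(x)`. -/
def logNormalizer (ρ : Measure ℝ) (β : ℝ) : ℝ := cgf id ρ β

/-- The mean `∫ x exp (β x - A(β)) dρ(x)` of the member with canonical parameter `β`. -/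
def canonicalMean (ρ : Measure ℝ) (β : ℝ) : ℝ :=
  ∫ x, x * Real.exp (β * x - logNormalizer ρ β) ∂ρ

/-- The family generated by `ρ` is regular and one-dimensional: its canonical parameter space is
open, and `ρ` is not concentrated in one point. -/
structure IsRegularFamily (ρ : Measure ℝ) : Prop where
  isOpen_canonicalSpace : IsOpen (canonicalSpace ρ)
  ne_dirac : ∀ a : ℝ, ρ ≠ Measure.dirac a

/-- The mean-value parameter space `M`. -/
def meanSpace (ρ : Measure ℝ) : Set ℝ := canonicalMean ρ '' canonicalSpace ρ

/-- The map `λ` from a mean value to the canonical parameter with that mean. -/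
def canonicalParam (ρ : Measure ℝ) (μ : ℝ) : ℝ :=
  Function.invFunOn (canonicalMean ρ) (canonicalSpace ρ) μ

/-- The density `p_μ(x) = exp (λ(μ) x - A(λ(μ)))` relative to `ρ`. -/
def density (ρ : Measure ℝ) (μ x : ℝ) : ℝ :=
  Real.exp (canonicalParam ρ μ * x - logNormalizer ρ (canonicalParam ρ μ))

/-- The distribution `P_μ`. -/
def law (ρ : Measure ℝ) (μ : ℝ) : Measure ℝ :=
  ρ.withDensity fun x => ENNReal.ofReal (density ρ μ x)

/-- The Fisher information `I(μ) = E_{P_μ}[(d/dμ log p_μ(X))²]` in the mean-value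
parameterization. -/
def fisherInfo (ρ : Measure ℝ) (μ : ℝ) : ℝ :=
  ∫ x, (deriv (fun m => Real.log (density ρ m x)) μ) ^ 2 ∂(law ρ μ)

/-! ### Blocks of `k` independent observations -/

variable {k : ℕ}

/-- The constant vector `⟨μ₀⟩ = (μ₀, …, μ₀)`. -/
def rep (k : ℕ) (μ₀ : ℝ) : Fin k → ℝ := fun _ => μ₀

/-- `M^(k)(μ₀)`: the vectors of mean values in `M` whose average is `μ₀`. -/
def alternatives (ρ : Measure ℝ) (k : ℕ) (μ₀ : ℝ) : Set (Fin k → ℝ) :=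
  {μ | (∀ j, μ j ∈ meanSpace ρ) ∧ (1 / (k : ℝ)) * ∑ j, μ j = μ₀}

/-- The Euclidean unit vectors of `ℝ^k` whose entries sum to `0`. -/
def directions (k : ℕ) : Set (Fin k → ℝ) :=
  {α | √(∑ j, α j ^ 2) = 1 ∧ ∑ j, α j = 0}

/-- `⟨μ₀⟩ + δ α`. -/
def shifted (μ₀ : ℝ) (α : Fin k → ℝ) (δ : ℝ) : Fin k → ℝ := rep k μ₀ + δ • α

/-- The joint density `p_μ(x^k) = ∏ p_{μ_i}(x_i)` relative to the product measure `ρ^k`. -/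
def jointDensity (ρ : Measure ℝ) (μ x : Fin k → ℝ) : ℝ := ∏ i, density ρ (μ i) (x i)

/-- The joint law `P_μ` of independent `X_i ∼ P_{μ_i}`. -/
def jointLaw (ρ : Measure ℝ) (μ : Fin k → ℝ) : Measure (Fin k → ℝ) :=
  Measure.pi fun i => law ρ (μ i)

/-- The statistic `Z = ∑ X_i`. -/
def sumStat (x : Fin k → ℝ) : ℝ := ∑ i, x i

/-- The law `P_{μ;[Z]}` of `Z` under `P_μ`. -/
def sumLaw (ρ : Measure ℝ) (μ : Fin k → ℝ) : Measure ℝ := (jointLaw ρ μ).map sumStat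

/-- `ρ_[Z]`: the image under `Z` of the product measure `ρ^k`. -/
def sumBase (ρ : Measure ℝ) (k : ℕ) : Measure ℝ :=
  (Measure.pi fun _ : Fin k => ρ).map sumStat

/-- The disintegration of `ρ^k` along `Z`: `fiber ρ k z` is the conditional distribution of
`X^k` given `Z = z` under `ρ^k`. -/
def fiber (ρ : Measure ℝ) [IsProbabilityMeasure ρ] (k : ℕ) : Kernel ℝ (Fin k → ℝ) :=
  condDistrib id sumStat (Measure.pi fun _ : Fin k => ρ)

/-- The density `p_{μ;[Z]}` of `Z` under `P_μ` relative to `ρ_[Z]`: the integral of the joint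
density over the fiber `Z = z`. -/
def sumDensity (ρ : Measure ℝ) [IsProbabilityMeasure ρ] (μ : Fin k → ℝ) (z : ℝ) : ℝ :=
  ∫ x, jointDensity ρ μ x ∂(fiber ρ k z)

/-- The conditional density of the block given the value of `Z`, at the block `x`: joint density
divided by the marginal density of `Z`. -/
def condDensity (ρ : Measure ℝ) [IsProbabilityMeasure ρ] (μ x : Fin k → ℝ) : ℝ :=
  jointDensity ρ μ x / sumDensity ρ μ (sumStat x)

/-- `S_pseudo = p_μ(X^k) / p_⟨μ₀*⟩(X^k)` with `μ₀*` the average of the `μ_i`. -/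
def Spseudo (ρ : Measure ℝ) (μ x : Fin k → ℝ) : ℝ :=
  jointDensity ρ μ x / jointDensity ρ (rep k ((1 / (k : ℝ)) * ∑ i, μ i)) x

/-- `S_cond = p_μ(X^k | Z) / p_⟨μ₀⟩(X^k | Z)`. -/
def Scond (ρ : Measure ℝ) [IsProbabilityMeasure ρ] (μ₀ : ℝ) (μ x : Fin k → ℝ) : ℝ :=
  condDensity ρ μ x / condDensity ρ (rep k μ₀) x

/-- `log S_pseudo - log S_cond` as a random variable on the block. -/
def logDiff (ρ : Measure ℝ) [IsProbabilityMeasure ρ] (μ₀ : ℝ) (μ x : Fin k → ℝ) : ℝ :=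
  Real.log (Spseudo ρ μ x) - Real.log (Scond ρ μ₀ μ x)

/-- `E_{P_μ}[log S_pseudo - log S_cond]`, for `μ = ⟨μ₀⟩ + δ α`, as a function of `δ`. -/
def growthDiff (ρ : Measure ℝ) [IsProbabilityMeasure ρ] (μ₀ : ℝ) (α : Fin k → ℝ) (δ : ℝ) : ℝ :=
  ∫ x, logDiff ρ μ₀ (shifted μ₀ α δ) x ∂(jointLaw ρ (shifted μ₀ α δ))

/-- `g_z(δ)`: the density of `Z` at `z` under `⟨μ₀⟩ + δ α`. -/
def g (ρ : Measure ℝ) [IsProbabilityMeasure ρ] (μ₀ : ℝ) (α : Fin k → ℝ) (z δ : ℝ) : ℝ :=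
  sumDensity ρ (shifted μ₀ α δ) z

/-- `p_⟨μ₀⟩(x^k)` times
`I(μ₀)² (∑ α_j (x_j - μ₀))² + ∑ α_j² (I'(μ₀) (x_j - μ₀) - I(μ₀))`. -/
def secondDerivIntegrand (ρ : Measure ℝ) (μ₀ : ℝ) (α x : Fin k → ℝ) : ℝ :=
  jointDensity ρ (rep k μ₀) x *
    (fisherInfo ρ μ₀ ^ 2 * (∑ j, α j * (x j - μ₀)) ^ 2 +
      ∑ j, α j ^ 2 * (deriv (fisherInfo ρ) μ₀ * (x j - μ₀) - fisherInfo ρ μ₀))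

end ExpFam

end

open ExpFam

/-! Since the entries of `α` sum to `0`, the average of the `μ_i` is `μ₀`, so the joint densities
cancel in `log S_pseudo - log S_cond`. What remains is `log (g_Z(δ) / g_Z(0))`, the log-likelihood
ratio of `Z` (`logDiff_ae_eq_llr`). Hence `f(δ)` is a divergence between two laws of `Z`, that is,
`∫ klFun (u δ z) dQ(z)` with `u = g_z(δ) / g_z(0)` and `Q` the law of `Z` under `⟨μ₀⟩`.

The density of `P_⟨μ₀⟩` depends on the block only through its sum, so it is constant on the fiber `Z
= z`, and `u δ z` is the fiber average of `p_μ / p_⟨μ₀⟩`. The first derivative of that ratio at `0`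
is `I(μ₀) ∑ α_j (x_j - μ₀)`. Given the sum, the block is exchangeable under `ρ^k`, so all `x_j` have
the same conditional mean and `∑ α_j = 0` kills the average (`IsRegularFamily.ae_sumPath_one_zero`).
Thus `u = 1 + δ² u''/2 + o(δ²)`, and `klFun v ~ (v - 1)² / 2` at `v = 1` gives `klFun u ~ δ⁴ (u'')²
/ 8`. Integrating against `Q`, whose density is `g_z(0)`, gives the stated coefficient.

The analytic work is domination. Near `δ = 0` the ratio, its reciprocal and its first three
derivatives are at most `C exp (t ∑ |x_i|)`, with `t` as small as desired
(`IsRegularFamily.exists_envelope`). By Jensen the fiber average `V` of this bound controls `u`,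
`1/u` and the derivatives of `u`, and it has a fifth moment under `Q` because the canonical space is
open. This suffices for three derivatives of `f` under the integral. The order `δ⁴` comes from
dominated convergence for `klFun u / δ⁴`, so a fourth derivative is never needed. -/

namespace ExpFam

/-! ### The mean-value parameterization -/

section Family

variable {ρ : Measure ℝ} {m : ℝ}

/-- The log-normalizer as a function of the mean value. -/
noncomputable def meanLogNormalizer (ρ : Measure ℝ) (m : ℝ) : ℝ :=
  logNormalizer ρ (canonicalParam ρ m)

lemma IsRegularFamily.mem_interior (hρ : IsRegularFamily ρ) {β : ℝ} (hβ : β ∈ canonicalSpace ρ) :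
    β ∈ interior (integrableExpSet id ρ) := by
  have h := hρ.isOpen_canonicalSpace.interior_eq
  rw [canonicalSpace] at h hβ
  rwa [h]

lemma canonicalParam_mem (hm : m ∈ meanSpace ρ) : canonicalParam ρ m ∈ canonicalSpace ρ :=
  Function.invFunOn_mem hm

lemma canonicalMean_canonicalParam (hm : m ∈ meanSpace ρ) :
    canonicalMean ρ (canonicalParam ρ m) = m :=
  Function.invFunOn_eq hm

lemma log_density (m x : ℝ) :
    Real.log (density ρ m x) = canonicalParam ρ m * x - meanLogNormalizer ρ m := by
  rw [density, Real.log_exp, meanLogNormalizer]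

lemma density_pos (m x : ℝ) : 0 < density ρ m x := Real.exp_pos _

@[fun_prop]
lemma measurable_density (m : ℝ) : Measurable (density ρ m) := by
  unfold density; fun_prop

variable [IsProbabilityMeasure ρ]

lemma exp_sub_logNormalizer {β : ℝ} (hβ : β ∈ canonicalSpace ρ) (x : ℝ) :
    Real.exp (β * x - logNormalizer ρ β) = Real.exp (β * x) / mgf id ρ β := by
  rw [Real.exp_sub, logNormalizer, exp_cgf hβ]

lemma IsRegularFamily.canonicalMean_eq (hρ : IsRegularFamily ρ) {β : ℝ}
    (hβ : β ∈ canonicalSpace ρ) : canonicalMean ρ β = deriv (cgf id ρ) β := by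
  rw [deriv_cgf (hρ.mem_interior hβ), canonicalMean, ← integral_div]
  simp_rw [exp_sub_logNormalizer hβ, id, mul_div_assoc]

/-- `A''(β)` is the variance of the tilted measure. If it vanished, `x` would be constant almost
surely under the tilted measure, hence under `ρ`, which would be a point mass. -/
lemma IsRegularFamily.deriv_deriv_cgf_pos (hρ : IsRegularFamily ρ) {β : ℝ}
    (hβ : β ∈ canonicalSpace ρ) : 0 < deriv (deriv (cgf id ρ)) β := by
  have hint := hρ.mem_interior hβ
  have hexp : Integrable (fun x : ℝ => Real.exp (β * id x)) ρ := hβ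
  have hvar := variance_tilted_mul hint
  have : iteratedDeriv 2 (cgf id ρ) β = deriv (deriv (cgf id ρ)) β := by
    rw [iteratedDeriv_succ, iteratedDeriv_one]
  rw [← this, ← hvar]
  refine lt_of_le_of_ne (variance_nonneg _ _) fun h0 => ?_
  have : IsProbabilityMeasure (ρ.tilted (β * id ·)) := isProbabilityMeasure_tilted hexp
  have hmem : MemLp id 2 (ρ.tilted (β * id ·)) := by
    simpa using memLp_tilted_mul hint 2
  have h1 : evariance id (ρ.tilted (β * id ·)) = 0 := by
    rw [← hmem.ofReal_variance_eq, ← h0, ENNReal.ofReal_zero]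
  rw [evariance_eq_zero_iff measurable_id.aemeasurable] at h1
  have h2 := (absolutelyContinuous_tilted hexp).ae_eq h1
  refine hρ.ne_dirac ((ρ.tilted (β * id ·))[id]) ?_
  conv_lhs => rw [← Measure.map_id (μ := ρ), Measure.map_congr h2]
  simp [Measure.map_const]

lemma IsRegularFamily.injOn_canonicalMean (hρ : IsRegularFamily ρ) :
    Set.InjOn (canonicalMean ρ) (canonicalSpace ρ) := by
  have hmono : StrictMonoOn (deriv (cgf id ρ)) (canonicalSpace ρ) := by
    refine strictMonoOn_of_deriv_pos convex_integrableExpSet ?_ ?_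
    · intro β hβ
      exact (analyticAt_cgf (hρ.mem_interior hβ)).deriv.continuousAt.continuousWithinAt
    · intro β hβ
      exact hρ.deriv_deriv_cgf_pos (interior_subset hβ)
  intro a ha b hb hab
  rw [hρ.canonicalMean_eq ha, hρ.canonicalMean_eq hb] at hab
  exact hmono.injOn ha hb hab

lemma IsRegularFamily.deriv_cgf_canonicalParam (hρ : IsRegularFamily ρ) (hm : m ∈ meanSpace ρ) :
    deriv (cgf id ρ) (canonicalParam ρ m) = m := by
  rw [← hρ.canonicalMean_eq (canonicalParam_mem hm), canonicalMean_canonicalParam hm]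

/-- Near every mean value, the mean-value space is a neighbourhood and the canonical parameter
agrees with the analytic local inverse of `A'`. -/
lemma IsRegularFamily.mem_nhds_and_analyticAt (hρ : IsRegularFamily ρ) (hm : m ∈ meanSpace ρ) :
    meanSpace ρ ∈ 𝓝 m ∧ AnalyticAt ℝ (canonicalParam ρ) m ∧
      HasDerivAt (canonicalParam ρ) (deriv (deriv (cgf id ρ)) (canonicalParam ρ m))⁻¹ m := by
  set β := canonicalParam ρ m with hβdef
  have hβ : β ∈ canonicalSpace ρ := canonicalParam_mem hm
  set f := deriv (cgf id ρ) with hf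
  have hfβ : f β = m := hρ.deriv_cgf_canonicalParam hm
  have han : AnalyticAt ℝ f β := (analyticAt_cgf (hρ.mem_interior hβ)).deriv
  have hpos : deriv f β ≠ 0 := (hρ.deriv_deriv_cgf_pos hβ).ne'
  have hcd : ContDiffAt ℝ ⊤ f β := han.contDiffAt
  have hd : HasDerivAt f (deriv f β) β := han.differentiableAt.hasDerivAt
  have hfd : HasFDerivAt f ((ContinuousLinearEquiv.unitsEquivAut ℝ (Units.mk0 _ hpos) :
      ℝ ≃L[ℝ] ℝ) : ℝ →L[ℝ] ℝ) β := by
    convert! hd.hasFDerivAt using 1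
  have hstrict := hcd.hasStrictFDerivAt' hfd (by simp)
  have hinv := hcd.to_localInverse hfd (by simp)
  set ψ := hcd.localInverse hfd (by simp) with hψ
  have hψm : ψ m = β := by
    rw [← hfβ]
    exact hcd.localInverse_apply_image hfd (by simp)
  rw [hfβ] at hinv
  have hright : ∀ᶠ y in 𝓝 m, f (ψ y) = y := by
    rw [← hfβ]
    exact hstrict.eventually_right_inverse
  have hmem : ∀ᶠ y in 𝓝 m, ψ y ∈ canonicalSpace ρ := by
    refine hinv.continuousAt.eventually_mem ?_
    rw [hψm]
    exact hρ.isOpen_canonicalSpace.mem_nhds hβ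
  have hM : ∀ᶠ y in 𝓝 m, y ∈ meanSpace ρ := by
    filter_upwards [hright, hmem] with y h1 h2
    exact ⟨ψ y, h2, by rw [hρ.canonicalMean_eq h2]; exact h1⟩
  -- `canonicalParam` is a mere choice of preimage; injectivity of the mean map forces it to agree
  -- with the smooth local inverse.
  have heq : canonicalParam ρ =ᶠ[𝓝 m] ψ := by
    filter_upwards [hright, hmem, hM] with y h1 h2 h3
    refine hρ.injOn_canonicalMean (canonicalParam_mem h3) h2 ?_
    rw [canonicalMean_canonicalParam h3, hρ.canonicalMean_eq h2]
    exact h1.symm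
  have hanp : AnalyticAt ℝ (canonicalParam ρ) m :=
    (hinv.congr_of_eventuallyEq heq).analyticAt
  refine ⟨hM, hanp, ?_⟩
  refine HasDerivAt.of_local_left_inverse hanp.continuousAt (by rwa [← hβdef]) hpos ?_
  filter_upwards [hM] with y hy using hρ.deriv_cgf_canonicalParam hy

lemma IsRegularFamily.isOpen_meanSpace (hρ : IsRegularFamily ρ) : IsOpen (meanSpace ρ) :=
  isOpen_iff_mem_nhds.2 fun _ hm => (hρ.mem_nhds_and_analyticAt hm).1

lemma IsRegularFamily.analyticAt_canonicalParam (hρ : IsRegularFamily ρ)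
    (hm : m ∈ meanSpace ρ) : AnalyticAt ℝ (canonicalParam ρ) m :=
  (hρ.mem_nhds_and_analyticAt hm).2.1

lemma IsRegularFamily.analyticAt_meanLogNormalizer (hρ : IsRegularFamily ρ)
    (hm : m ∈ meanSpace ρ) : AnalyticAt ℝ (meanLogNormalizer ρ) m :=
  AnalyticAt.comp (g := cgf id ρ) (analyticAt_cgf (hρ.mem_interior (canonicalParam_mem hm)))
    (hρ.analyticAt_canonicalParam hm)

/-- Chain rule together with `A'(λ(m)) = m`. -/
lemma IsRegularFamily.deriv_meanLogNormalizer (hρ : IsRegularFamily ρ) (hm : m ∈ meanSpace ρ) :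
    deriv (meanLogNormalizer ρ) m = m * deriv (canonicalParam ρ) m := by
  have h1 : HasDerivAt (cgf id ρ) m (canonicalParam ρ m) := by
    have := (analyticAt_cgf (hρ.mem_interior (canonicalParam_mem hm))).differentiableAt.hasDerivAt
    rwa [hρ.deriv_cgf_canonicalParam hm] at this
  exact (h1.comp m (hρ.analyticAt_canonicalParam hm).differentiableAt.hasDerivAt).deriv

lemma IsRegularFamily.deriv_deriv_meanLogNormalizer (hρ : IsRegularFamily ρ)
    (hm : m ∈ meanSpace ρ) :
    deriv (deriv (meanLogNormalizer ρ)) m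
      = deriv (canonicalParam ρ) m + m * deriv (deriv (canonicalParam ρ)) m := by
  have h : deriv (meanLogNormalizer ρ) =ᶠ[𝓝 m] fun y => y * deriv (canonicalParam ρ) y := by
    filter_upwards [hρ.isOpen_meanSpace.mem_nhds hm] with y hy
    exact hρ.deriv_meanLogNormalizer hy
  rw [h.deriv_eq]
  have := (hasDerivAt_id m).mul
    (hρ.analyticAt_canonicalParam hm).deriv.differentiableAt.hasDerivAt
  simpa [Pi.mul_def] using this.deriv

lemma law_eq_tilted (hm : m ∈ meanSpace ρ) :
    law ρ m = ρ.tilted (canonicalParam ρ m * id ·) := by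
  rw [law, Measure.tilted]
  congr 1
  ext x
  rw [density, exp_sub_logNormalizer (canonicalParam_mem hm)]
  rfl

lemma isProbabilityMeasure_law (hm : m ∈ meanSpace ρ) : IsProbabilityMeasure (law ρ m) := by
  rw [law_eq_tilted hm]
  exact isProbabilityMeasure_tilted (canonicalParam_mem hm)

/-- The score is `λ'(m) (x - m)` and the variance of `P_m` is `A''(λ(m)) = 1 / λ'(m)`, so the
information is `λ'² / λ'`. Smoothness of `I` is thereby reduced to that of `λ`. -/
lemma IsRegularFamily.fisherInfo_eq (hρ : IsRegularFamily ρ) (hm : m ∈ meanSpace ρ) :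
    fisherInfo ρ m = deriv (canonicalParam ρ) m := by
  have hint := hρ.mem_interior (canonicalParam_mem hm)
  have hscore : ∀ x, deriv (fun y => Real.log (density ρ y x)) m
      = deriv (canonicalParam ρ) m * (x - m) := by
    intro x
    simp_rw [log_density]
    rw [deriv_fun_sub
      ((hρ.analyticAt_canonicalParam hm).differentiableAt.mul_const x)
      (hρ.analyticAt_meanLogNormalizer hm).differentiableAt,
      deriv_mul_const (hρ.analyticAt_canonicalParam hm).differentiableAt,
      hρ.deriv_meanLogNormalizer hm]
    ring
  have hvar : ∫ x, (x - m) ^ 2 ∂(law ρ m) = deriv (deriv (cgf id ρ)) (canonicalParam ρ m) := by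
    have h := variance_tilted_mul hint
    rw [variance_eq_integral measurable_id.aemeasurable, integral_tilted_mul_self hint,
      hρ.deriv_cgf_canonicalParam hm, iteratedDeriv_succ, iteratedDeriv_one] at h
    rw [law_eq_tilted hm, ← h]
    rfl
  simp_rw [fisherInfo, hscore, mul_pow]
  rw [integral_const_mul, hvar, (hρ.mem_nhds_and_analyticAt hm).2.2.deriv]
  have := (hρ.deriv_deriv_cgf_pos (canonicalParam_mem hm)).ne'
  field_simp

lemma IsRegularFamily.fisherInfo_eventuallyEq (hρ : IsRegularFamily ρ) (hm : m ∈ meanSpace ρ) :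
    fisherInfo ρ =ᶠ[𝓝 m] deriv (canonicalParam ρ) := by
  filter_upwards [hρ.isOpen_meanSpace.mem_nhds hm] with y hy using hρ.fisherInfo_eq hy

lemma IsRegularFamily.differentiableAt_fisherInfo (hρ : IsRegularFamily ρ)
    (hm : m ∈ meanSpace ρ) : DifferentiableAt ℝ (fisherInfo ρ) m :=
  (hρ.analyticAt_canonicalParam hm).deriv.differentiableAt.congr_of_eventuallyEq
    (hρ.fisherInfo_eventuallyEq hm)

end Family

/-! ### Differentiation chains and parametric integrals -/

/-- Derivatives are carried throughout as explicit sequences `G 0, G 1, …`, each the derivative of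
its predecessor. This lemma and the next turn such a sequence into iterated derivatives and
smoothness. -/
lemma iteratedDeriv_eqOn_of_hasDerivAt {s : Set ℝ} (hs : IsOpen s) {n : ℕ} {G : ℕ → ℝ → ℝ}
    (hG : ∀ j < n, ∀ x ∈ s, HasDerivAt (G j) (G (j + 1) x) x) :
    ∀ j ≤ n, ∀ x ∈ s, iteratedDeriv j (G 0) x = G j x := by
  intro j
  induction j with
  | zero => simp
  | succ j ih =>
    intro hj x hx
    have hev : iteratedDeriv j (G 0) =ᶠ[𝓝 x] G j := by
      filter_upwards [hs.mem_nhds hx] with y hy using ih (by lia) y hy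
    rw [iteratedDeriv_succ, hev.deriv_eq, (hG j (by lia) x hx).deriv]

lemma contDiffOn_of_hasDerivAt {s : Set ℝ} (hs : IsOpen s) {n : ℕ} {G : ℕ → ℝ → ℝ}
    (hG : ∀ j < n, ∀ x ∈ s, HasDerivAt (G j) (G (j + 1) x) x) (hc : ContinuousOn (G n) s) :
    ContDiffOn ℝ n (G 0) s := by
  induction n generalizing G with
  | zero => simpa using hc
  | succ n ih =>
    have h := ih (G := fun j => G (j + 1)) (fun j hj => hG (j + 1) (by lia)) hc
    rw [Nat.cast_succ, contDiffOn_succ_iff_deriv_of_isOpen hs]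
    refine ⟨fun x hx => (hG 0 (by lia) x hx).differentiableAt.differentiableWithinAt,
      by simp, h.congr fun x hx => (hG 0 (by lia) x hx).deriv⟩

section ParametricIntegral

variable {Ω : Type*} {mΩ : MeasurableSpace Ω} {μ : Measure Ω} {s : Set ℝ} {n : ℕ}
  {F : ℕ → ℝ → Ω → ℝ} {bound : Ω → ℝ}

/-- A chain of successive derivatives that is uniformly dominated may be integrated. -/
lemma hasDerivAt_integral_chain (hs : IsOpen s)
    (hmeas : ∀ j ≤ n, ∀ δ ∈ s, AEStronglyMeasurable (F j δ) μ)
    (hbound : ∀ᵐ ω ∂μ, ∀ j ≤ n, ∀ δ ∈ s, |F j δ ω| ≤ bound ω) (hint : Integrable bound μ)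
    (hderiv : ∀ᵐ ω ∂μ, ∀ j < n, ∀ δ ∈ s, HasDerivAt (F j · ω) (F (j + 1) δ ω) δ)
    {j : ℕ} (hj : j < n) {δ : ℝ} (hδ : δ ∈ s) :
    HasDerivAt (fun δ => ∫ ω, F j δ ω ∂μ) (∫ ω, F (j + 1) δ ω ∂μ) δ := by
  refine (hasDerivAt_integral_of_dominated_loc_of_deriv_le (hs.mem_nhds hδ)
    ?_ ?_ (hmeas (j + 1) hj δ hδ) ?_ hint ?_).2
  · filter_upwards [hs.mem_nhds hδ] with y hy using hmeas j hj.le y hy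
  · refine hint.mono' (hmeas j hj.le δ hδ) ?_
    filter_upwards [hbound] with ω h using h j hj.le δ hδ
  · filter_upwards [hbound] with ω h x hx using h (j + 1) hj x hx
  · filter_upwards [hderiv] with ω h x hx using h j hj x hx

lemma continuousOn_integral_chain
    (hmeas : ∀ j ≤ n, ∀ δ ∈ s, AEStronglyMeasurable (F j δ) μ)
    (hbound : ∀ᵐ ω ∂μ, ∀ j ≤ n, ∀ δ ∈ s, |F j δ ω| ≤ bound ω) (hint : Integrable bound μ)
    (hcont : ∀ᵐ ω ∂μ, ContinuousOn (F n · ω) s) :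
    ContinuousOn (fun δ => ∫ ω, F n δ ω ∂μ) s := by
  refine continuousOn_of_dominated (hmeas n le_rfl) (fun δ hδ => ?_) hint hcont
  filter_upwards [hbound] with ω h using h n le_rfl δ hδ

end ParametricIntegral

/-! ### The Kullback-Leibler divergence along a path of densities -/

/-- If `φ(a) = φ'(a) = 0` and `φ'` has derivative `c` at `a` then `φ(x) / (x - a)² → c / 2`. -/
lemma tendsto_div_sq_of_hasDerivAt {s : Set ℝ} {φ φ' : ℝ → ℝ} {a c : ℝ} (hs : Convex ℝ s)
    (ha : s ∈ 𝓝 a) (hφ : ∀ x ∈ s, HasDerivAt φ (φ' x) x) (h0 : φ a = 0) (h1 : φ' a = 0)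
    (h2 : HasDerivAt φ' c a) :
    Tendsto (fun x => φ x / (x - a) ^ 2) (𝓝[≠] a) (𝓝 (c / 2)) := by
  -- Once the expected quadratic is subtracted, the derivative is `o(x - a)`; integrating this on a
  -- convex set makes the remainder `o((x - a)²)`.
  have hder : ∀ x ∈ s, HasDerivWithinAt (fun x => φ x - c / 2 * (x - a) ^ 2)
      (φ' x - c * (x - a)) s x := by
    intro x hx
    have := (((hasDerivAt_id' x).sub_const a).fun_pow 2).const_mul (c / 2)
    refine ((hφ x hx).sub this).hasDerivWithinAt.congr_deriv ?_
    simp; ring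
  have hlit : (fun x => φ' x - c * (x - a)) =o[𝓝[s] a] fun x => (x - a) ^ 1 := by
    have := (hasDerivAt_iff_isLittleO.1 h2).mono (nhdsWithin_le_nhds (s := s))
    simpa [h1, mul_comm] using this
  have hmain := hs.isLittleO_pow_succ_real (mem_of_mem_nhds ha) hder hlit
  rw [nhdsWithin_eq_nhds.2 ha] at hmain
  simp only [h0, sub_self, ne_eq, OfNat.ofNat_ne_zero, not_false_eq_true, zero_pow, mul_zero,
    sub_zero, one_add_one_eq_two] at hmain
  have ht := (hmain.mono (nhdsWithin_le_nhds (s := {a}ᶜ))).tendsto_div_nhds_zero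
  have := ht.add_const (c / 2)
  rw [zero_add] at this
  refine this.congr' ?_
  filter_upwards [self_mem_nhdsWithin] with x hx
  have : x - a ≠ 0 := sub_ne_zero.2 hx
  field_simp
  ring

/-- The quotient `klFun v / (v - 1)²`, extended by its limit `1 / 2` at `v = 1`. -/
noncomputable def klQuot : ℝ → ℝ := Function.update (fun v => klFun v / (v - 1) ^ 2) 1 (1 / 2)

lemma continuousAt_klQuot : ContinuousAt klQuot 1 := by
  rw [klQuot, continuousAt_update_same]
  refine tendsto_div_sq_of_hasDerivAt (s := Set.Ioi 0) (φ' := Real.log) (convex_Ioi 0)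
    (Ioi_mem_nhds one_pos) (fun x hx => hasDerivAt_klFun (ne_of_gt hx)) klFun_one Real.log_one ?_
  simpa using Real.hasDerivAt_log one_ne_zero

lemma klFun_eq_klQuot (v : ℝ) : klFun v = klQuot v * (v - 1) ^ 2 := by
  by_cases h : v = 1
  · simp [h, klFun_one]
  · have : v - 1 ≠ 0 := sub_ne_zero.2 h
    rw [klQuot, Function.update_of_ne h]
    field_simp

lemma klFun_le_sq {v : ℝ} (hv : 0 < v) : klFun v ≤ (v - 1) ^ 2 := by
  rw [klFun_apply]
  nlinarith [mul_le_mul_of_nonneg_left (Real.log_le_sub_one_of_pos hv) hv.le]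

/-- The successive derivatives of `klFun ∘ u`, in terms of the derivatives `u j` of `u = u 0`. -/
noncomputable def klChain (u : ℕ → ℝ) : ℕ → ℝ
  | 0 => klFun (u 0)
  | 1 => Real.log (u 0) * u 1
  | 2 => u 1 ^ 2 / u 0 + Real.log (u 0) * u 2
  | _ => 3 * u 1 * u 2 / u 0 - u 1 ^ 3 / u 0 ^ 2 + Real.log (u 0) * u 3

lemma hasDerivAt_klChain {u : ℕ → ℝ → ℝ} {x : ℝ} (hpos : 0 < u 0 x)
    (hu : ∀ j < 3, HasDerivAt (u j) (u (j + 1) x) x) {j : ℕ} (hj : j < 3) :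
    HasDerivAt (fun y => klChain (u · y) j) (klChain (u · x) (j + 1)) x := by
  have h0 := hu 0 (by lia)
  have h1 := hu 1 (by lia)
  have h2 := hu 2 (by lia)
  have hne := hpos.ne'
  interval_cases j
  · exact (hasDerivAt_klFun hne).comp x h0
  · refine ((h0.log hne).mul h1).congr_deriv ?_
    simp only [klChain]
    ring
  · refine (((h1.fun_pow 2).fun_div h0 hne).add ((h0.log hne).mul h2)).congr_deriv ?_
    simp only [klChain]
    field_simp
    ring

lemma continuousOn_klChain_three {u : ℕ → ℝ → ℝ} {s : Set ℝ} (hpos : ∀ x ∈ s, 0 < u 0 x)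
    (hu : ∀ j ≤ 3, ContinuousOn (u j) s) : ContinuousOn (fun y => klChain (u · y) 3) s := by
  have h0 := hu 0 (by lia)
  have h1 := hu 1 (by lia)
  have h2 := hu 2 (by lia)
  have h3 := hu 3 (by lia)
  have hne : ∀ x ∈ s, u 0 x ≠ 0 := fun x hx => (hpos x hx).ne'
  simp only [klChain]
  exact ((((continuousOn_const.mul h1).mul h2).div h0 hne).sub
    ((h1.pow 3).div (h0.pow 2) fun x hx => pow_ne_zero 2 (hne x hx))).add ((h0.log hne).mul h3)

lemma measurable_klChain {Ω : Type*} {mΩ : MeasurableSpace Ω} {u : ℕ → Ω → ℝ}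
    (hu : ∀ j ≤ 3, Measurable (u j)) {j : ℕ} (hj : j ≤ 3) :
    Measurable fun ω => klChain (u · ω) j := by
  have h0 := hu 0 (by lia)
  have h1 := hu 1 (by lia)
  have h2 := hu 2 (by lia)
  have h3 := hu 3 (by lia)
  interval_cases j <;> simp only [klChain] <;> fun_prop

/-- The worst term is `u 1 ^ 3 / u 0 ^ 2`, of size `V³ · V²`; this is why a fifth moment of the
envelope is required. The factor `5 = 3 + 1 + 1` sums the coefficients in the third derivative. -/
lemma abs_klChain_le {u : ℕ → ℝ} {V : ℝ} (hV : 1 ≤ V) (hlow : V⁻¹ ≤ u 0)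
    (hu : ∀ j ≤ 3, |u j| ≤ V) {j : ℕ} (hj : j ≤ 3) : |klChain u j| ≤ 5 * V ^ 5 := by
  have hV0 : 0 < V := by linarith
  have hpos : 0 < u 0 := (inv_pos.2 hV0).trans_le hlow
  have h0 : u 0 ≤ V := (le_abs_self _).trans (hu 0 (by lia))
  have h1 := hu 1 (by lia)
  have h2 := hu 2 (by lia)
  have h3 := hu 3 (by lia)
  have hlogV : Real.log V ≤ V := (Real.log_le_sub_one_of_pos hV0).trans (by linarith)
  have hlog : |Real.log (u 0)| ≤ V := by
    rw [abs_le]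
    constructor
    · have := Real.log_le_log (inv_pos.2 hV0) hlow
      rw [Real.log_inv] at this
      linarith
    · exact (Real.log_le_log hpos h0).trans hlogV
  have hinv : |(u 0)⁻¹| ≤ V := by
    rw [abs_of_pos (inv_pos.2 hpos)]
    exact inv_le_of_inv_le₀ hV0 hlow
  have hmono : ∀ i ≤ 5, V ^ i ≤ V ^ 5 := fun i hi => pow_le_pow_right₀ hV hi
  have e0 := hmono 0 (by lia)
  have e1 := hmono 1 (by lia)
  have e2 := hmono 2 (by lia)
  have e3 := hmono 3 (by lia)
  interval_cases j
  · have : |Real.log (u 0) * u 0| ≤ V * V := by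
      rw [abs_mul]; gcongr; exact hu 0 (by lia)
    simp only [klChain, klFun_apply]
    rw [abs_le] at this ⊢
    constructor <;> nlinarith
  · have : |Real.log (u 0) * u 1| ≤ V * V := by rw [abs_mul]; gcongr
    simp only [klChain]
    nlinarith
  · have a1 : |u 1 ^ 2 * (u 0)⁻¹| ≤ V ^ 2 * V := by rw [abs_mul, abs_pow]; gcongr
    have a2 : |Real.log (u 0) * u 2| ≤ V * V := by rw [abs_mul]; gcongr
    simp only [klChain]
    rw [div_eq_mul_inv]
    refine (abs_add_le _ _).trans ?_
    nlinarith
  · have a1 : |3 * u 1 * u 2 * (u 0)⁻¹| ≤ 3 * V * V * V := by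
      rw [abs_mul, abs_mul, abs_mul, abs_of_pos (three_pos (α := ℝ))]; gcongr
    have a2 : |u 1 ^ 3 * (u 0)⁻¹ ^ 2| ≤ V ^ 3 * V ^ 2 := by
      rw [abs_mul, abs_pow, abs_pow]; gcongr
    have a3 : |Real.log (u 0) * u 3| ≤ V * V := by rw [abs_mul]; gcongr
    simp only [klChain]
    rw [div_eq_mul_inv, div_eq_mul_inv, ← inv_pow]
    refine (abs_add_le _ _).trans ((add_le_add_left (abs_sub _ _) _).trans ?_)
    nlinarith

/-- A path `δ ↦ u 0 δ` of positive functions on a measure space, differentiable three times for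
`|δ| < r` with derivatives `u 1`, `u 2`, `u 3`, that starts in the constant `1` with vanishing
first derivative, everything being controlled by an envelope `V` with a fifth moment. -/
structure DominatedPath {Ω : Type*} [MeasurableSpace Ω] (Q : Measure Ω) (r : ℝ)
    (u : ℕ → ℝ → Ω → ℝ) (V : Ω → ℝ) : Prop where
  pos : 0 < r
  measurable : ∀ j ≤ 3, ∀ δ ∈ Set.Ioo (-r) r, Measurable (u j δ)
  one_le : ∀ᵐ z ∂Q, 1 ≤ V z
  inv_le : ∀ᵐ z ∂Q, ∀ δ ∈ Set.Ioo (-r) r, (V z)⁻¹ ≤ u 0 δ z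
  abs_le : ∀ᵐ z ∂Q, ∀ j ≤ 3, ∀ δ ∈ Set.Ioo (-r) r, |u j δ z| ≤ V z
  integrable : Integrable (fun z => V z ^ 5) Q
  hasDerivAt : ∀ᵐ z ∂Q, ∀ j < 3, ∀ δ ∈ Set.Ioo (-r) r, HasDerivAt (u j · z) (u (j + 1) δ z) δ
  continuousOn : ∀ᵐ z ∂Q, ContinuousOn (u 3 · z) (Set.Ioo (-r) r)
  zero_eq : ∀ᵐ z ∂Q, u 0 0 z = 1
  one_eq : ∀ᵐ z ∂Q, u 1 0 z = 0

namespace DominatedPath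

variable {Ω : Type*} [MeasurableSpace Ω] {Q : Measure Ω} {r : ℝ} {u : ℕ → ℝ → Ω → ℝ} {V : Ω → ℝ}

lemma zero_mem (h : DominatedPath Q r u V) : (0 : ℝ) ∈ Set.Ioo (-r) r :=
  ⟨by linarith [h.pos], h.pos⟩

lemma integrable_klChain_bound (h : DominatedPath Q r u V) :
    Integrable (fun z => 5 * V z ^ 5) Q := h.integrable.const_mul 5

lemma aestronglyMeasurable_klChain (h : DominatedPath Q r u V) :
    ∀ j ≤ 3, ∀ δ ∈ Set.Ioo (-r) r,
      AEStronglyMeasurable (fun z => klChain (u · δ z) j) Q := fun _ hj δ hδ =>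
  (measurable_klChain (u := fun i z => u i δ z) (fun i hi => h.measurable i hi δ hδ)
    hj).aestronglyMeasurable

lemma ae_abs_klChain_le (h : DominatedPath Q r u V) :
    ∀ᵐ z ∂Q, ∀ j ≤ 3, ∀ δ ∈ Set.Ioo (-r) r, |klChain (u · δ z) j| ≤ 5 * V z ^ 5 := by
  filter_upwards [h.one_le, h.inv_le, h.abs_le] with z h1 h2 h3 j hj δ hδ
  exact abs_klChain_le h1 (h2 δ hδ) (fun i hi => h3 i hi δ hδ) hj

lemma ae_pos (h : DominatedPath Q r u V) : ∀ᵐ z ∂Q, ∀ δ ∈ Set.Ioo (-r) r, 0 < u 0 δ z := by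
  filter_upwards [h.one_le, h.inv_le] with z h1 h2 δ hδ
  exact (inv_pos.2 (by linarith)).trans_le (h2 δ hδ)

lemma hasDerivAt_integral_klChain (h : DominatedPath Q r u V) :
    ∀ j < 3, ∀ δ ∈ Set.Ioo (-r) r, HasDerivAt (fun δ => ∫ z, klChain (u · δ z) j ∂Q)
      (∫ z, klChain (u · δ z) (j + 1) ∂Q) δ := by
  intro j hj δ hδ
  refine hasDerivAt_integral_chain (F := fun j δ z => klChain (u · δ z) j) isOpen_Ioo
    h.aestronglyMeasurable_klChain h.ae_abs_klChain_le h.integrable_klChain_bound ?_ hj hδ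
  filter_upwards [h.ae_pos, h.hasDerivAt] with z h1 h2 j hj δ hδ
  exact hasDerivAt_klChain (u := fun i y => u i y z) (h1 δ hδ) (fun i hi => h2 i hi δ hδ) hj

lemma contDiffAt_integral_klFun (h : DominatedPath Q r u V) :
    ContDiffAt ℝ 3 (fun δ => ∫ z, klFun (u 0 δ z) ∂Q) 0 := by
  refine (contDiffOn_of_hasDerivAt (n := 3) (G := fun j δ => ∫ z, klChain (u · δ z) j ∂Q)
    isOpen_Ioo h.hasDerivAt_integral_klChain ?_).contDiffAt (isOpen_Ioo.mem_nhds h.zero_mem)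
  refine continuousOn_integral_chain (F := fun j δ z => klChain (u · δ z) j)
    h.aestronglyMeasurable_klChain h.ae_abs_klChain_le h.integrable_klChain_bound ?_
  filter_upwards [h.ae_pos, h.hasDerivAt, h.continuousOn] with z h1 h2 h3
  refine continuousOn_klChain_three (u := fun i y => u i y z) h1 fun i hi => ?_
  rcases hi.lt_or_eq with hi | rfl
  · exact fun x hx => (h2 i hi x hx).continuousAt.continuousWithinAt
  · exact h3

/-- Every term of the first three derivatives contains a factor `u 1` or `log (u 0)`, and both
vanish at `δ = 0`. -/
lemma iteratedDeriv_integral_klFun (h : DominatedPath Q r u V) {j : ℕ} (hj1 : 1 ≤ j)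
    (hj3 : j ≤ 3) : iteratedDeriv j (fun δ => ∫ z, klFun (u 0 δ z) ∂Q) 0 = 0 := by
  have := iteratedDeriv_eqOn_of_hasDerivAt (G := fun j δ => ∫ z, klChain (u · δ z) j ∂Q)
    isOpen_Ioo h.hasDerivAt_integral_klChain j hj3 0 h.zero_mem
  simp only [klChain] at this
  rw [this]
  refine integral_eq_zero_of_ae ?_
  filter_upwards [h.zero_eq, h.one_eq] with z h0 h1
  interval_cases j <;> simp [h0, h1]

lemma integrable_sq (h : DominatedPath Q r u V) : Integrable (fun z => u 2 0 z ^ 2) Q := by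
  refine h.integrable.mono' ((h.measurable 2 (by lia) 0 h.zero_mem).pow_const 2
    |>.aestronglyMeasurable) ?_
  filter_upwards [h.one_le, h.abs_le] with z h1 h2
  have := h2 2 (by lia) 0 h.zero_mem
  rw [Real.norm_eq_abs, abs_pow]
  calc |u 2 0 z| ^ 2 ≤ V z ^ 2 := by gcongr
    _ ≤ V z ^ 5 := pow_le_pow_right₀ h1 (by lia)

/-- The mean value inequality is applied twice: the bound on `u 2` makes `u 1` of order `δ`, which
makes `u 0 - 1` of order `δ²`. -/
lemma ae_abs_sub_one_le (h : DominatedPath Q r u V) :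
    ∀ᵐ z ∂Q, ∀ δ ∈ Set.Ioo (-r) r, |u 0 δ z - 1| ≤ V z * δ ^ 2 := by
  filter_upwards [h.abs_le, h.hasDerivAt, h.zero_eq, h.one_eq] with z h1 h2 h3 h4 δ hδ
  have hsub : ∀ y ∈ Set.uIcc 0 δ, y ∈ Set.Ioo (-r) r ∧ |y| ≤ |δ| := by
    intro y hy
    refine ⟨Set.ordConnected_Ioo.uIcc_subset h.zero_mem hδ hy, ?_⟩
    simpa using Set.abs_sub_left_of_mem_uIcc hy
  have hone : ∀ y ∈ Set.uIcc 0 δ, |u 1 y z| ≤ V z * |δ| := by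
    intro y hy
    have := (convex_uIcc 0 δ).norm_image_sub_le_of_norm_hasDerivWithin_le
      (fun x hx => (h2 1 (by lia) x (hsub x hx).1).hasDerivWithinAt)
      (fun x hx => h1 2 (by lia) x (hsub x hx).1) Set.left_mem_uIcc hy
    simp only [h4, sub_zero, Real.norm_eq_abs] at this
    exact this.trans (mul_le_mul_of_nonneg_left (hsub y hy).2
      ((abs_nonneg _).trans (h1 0 (by lia) 0 h.zero_mem)))
  have := (convex_uIcc 0 δ).norm_image_sub_le_of_norm_hasDerivWithin_le
    (fun x hx => (h2 0 (by lia) x (hsub x hx).1).hasDerivWithinAt)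
    hone Set.left_mem_uIcc Set.right_mem_uIcc
  simp only [h3, sub_zero, Real.norm_eq_abs] at this
  rwa [mul_assoc, ← sq, sq_abs] at this

/-- Pointwise, `klFun u / δ⁴ = klQuot u · ((u - 1) / δ²)²` tends to `1/2 · (u''/2)²`. Since `klFun u
≤ (u - 1)²`, the quotient is dominated by `V² ≤ V⁵`. -/
lemma tendsto_integral_klFun_div (h : DominatedPath Q r u V) :
    Tendsto (fun δ => (∫ z, klFun (u 0 δ z) ∂Q) / δ ^ 4) (𝓝[≠] 0)
      (𝓝 (1 / 8 * ∫ z, u 2 0 z ^ 2 ∂Q)) := by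
  have hnear : ∀ᶠ δ : ℝ in 𝓝[≠] 0, δ ∈ Set.Ioo (-r) r ∧ δ ≠ 0 := by
    filter_upwards [nhdsWithin_le_nhds (isOpen_Ioo.mem_nhds h.zero_mem), self_mem_nhdsWithin]
      with δ h1 h2 using ⟨h1, h2⟩
  rw [← integral_const_mul]
  simp_rw [← integral_div]
  refine tendsto_integral_filter_of_dominated_convergence (fun z => V z ^ 5) ?_ ?_ h.integrable ?_
  · filter_upwards [hnear] with δ hδ
    exact ((measurable_klFun.comp (h.measurable 0 (by lia) δ hδ.1)).div_const _).aestronglyMeasurable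
  · filter_upwards [hnear] with δ hδ
    filter_upwards [h.one_le, h.ae_pos, h.ae_abs_sub_one_le] with z h1 h2 h3
    have hp := h2 δ hδ.1
    have hδ4 : 0 < δ ^ 4 := by have := hδ.2; positivity
    rw [Real.norm_eq_abs, abs_of_nonneg (div_nonneg (klFun_nonneg hp.le) hδ4.le), div_le_iff₀ hδ4]
    calc klFun (u 0 δ z) ≤ (u 0 δ z - 1) ^ 2 := klFun_le_sq hp
      _ = |u 0 δ z - 1| ^ 2 := (sq_abs _).symm
      _ ≤ (V z * δ ^ 2) ^ 2 := by gcongr; exact h3 δ hδ.1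
      _ = V z ^ 2 * δ ^ 4 := by ring
      _ ≤ V z ^ 5 * δ ^ 4 := by
        gcongr
        exact Nat.le_of_ble_eq_true rfl
  · filter_upwards [h.hasDerivAt, h.zero_eq, h.one_eq] with z h2 h3 h4
    have hq : Tendsto (fun δ => (u 0 δ z - 1) / (δ - 0) ^ 2) (𝓝[≠] 0) (𝓝 (u 2 0 z / 2)) :=
      tendsto_div_sq_of_hasDerivAt (φ := fun δ => u 0 δ z - 1) (φ' := fun δ => u 1 δ z)
        (convex_Ioo (-r) r) (isOpen_Ioo.mem_nhds h.zero_mem)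
        (fun x hx => (h2 0 (by lia) x hx).sub_const 1) (by simp [h3]) h4
        (h2 1 (by lia) 0 h.zero_mem)
    have hu : Tendsto (fun δ => u 0 δ z) (𝓝[≠] 0) (𝓝 1) := by
      have := (h2 0 (by lia) 0 h.zero_mem).continuousAt.tendsto
      rw [h3] at this
      exact this.mono_left nhdsWithin_le_nhds
    have hk : Tendsto (fun δ => klQuot (u 0 δ z)) (𝓝[≠] 0) (𝓝 (1 / 2)) := by
      have := continuousAt_klQuot.tendsto.comp hu
      simpa [klQuot, Function.comp_def] using this
    have := hk.mul (hq.pow 2)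
    rw [show 1 / 2 * (u 2 0 z / 2) ^ 2 = 1 / 8 * u 2 0 z ^ 2 by ring] at this
    refine this.congr fun δ => ?_
    rw [klFun_eq_klQuot (u 0 δ z), sub_zero, div_pow, ← pow_mul, mul_div_assoc]

lemma integral_klFun_isLittleO (h : DominatedPath Q r u V) :
    (fun δ => (∫ z, klFun (u 0 δ z) ∂Q) - 1 / 8 * (∫ z, u 2 0 z ^ 2 ∂Q) * δ ^ 4)
      =o[𝓝 0] fun δ => δ ^ 4 := by
  have h0 : ∫ z, klFun (u 0 0 z) ∂Q = 0 := by
    refine integral_eq_zero_of_ae ?_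
    filter_upwards [h.zero_eq] with z hz
    simp [hz, klFun_one]
  have hzero : ∀ δ : ℝ, δ ^ 4 = 0 →
      (∫ z, klFun (u 0 δ z) ∂Q) - 1 / 8 * (∫ z, u 2 0 z ^ 2 ∂Q) * δ ^ 4 = 0 := by
    intro δ hδ
    have : δ = 0 := by simpa using hδ
    simp [this, h0]
  -- The limit already proved is punctured. The point `δ = 0` is split off; the quotient there is
  -- `0`.
  rw [isLittleO_iff_tendsto hzero, show 𝓝 (0 : ℝ) = 𝓝[≠] 0 ⊔ pure 0 from (nhdsNE_sup_pure 0).symm,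
    tendsto_sup, nhdsNE_sup_pure]
  refine ⟨?_, ?_⟩
  · have := h.tendsto_integral_klFun_div.sub_const (1 / 8 * ∫ z, u 2 0 z ^ 2 ∂Q)
    rw [sub_self] at this
    refine this.congr' ?_
    filter_upwards [self_mem_nhdsWithin] with δ hδ
    have : δ ≠ 0 := hδ
    field_simp
  · rw [tendsto_pure_left]
    intro s hs
    simpa [h0] using mem_of_mem_nhds hs

end DominatedPath

/-! ### Measures with positive densities -/

section WithDensity

variable {Ω : Type*} {mΩ : MeasurableSpace Ω} {ν : Measure Ω} {p q : Ω → ℝ}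

lemma withDensity_ofReal_eq_withDensity_div (hp : Measurable p) (hq : Measurable q)
    (hq0 : ∀ᵐ x ∂ν, 0 < q x) :
    ν.withDensity (fun x => ENNReal.ofReal (p x))
      = (ν.withDensity fun x => ENNReal.ofReal (q x)).withDensity
          fun x => ENNReal.ofReal (p x / q x) := by
  rw [← withDensity_mul ν hq.ennreal_ofReal (by fun_prop)]
  refine withDensity_congr_ae ?_
  filter_upwards [hq0] with x hx
  rw [Pi.mul_apply, ← ENNReal.ofReal_mul hx.le, mul_div_cancel₀ _ hx.ne']

lemma rnDeriv_withDensity_withDensity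
    [SigmaFinite (ν.withDensity fun x => ENNReal.ofReal (q x))]
    (hp : Measurable p) (hq : Measurable q) (hq0 : ∀ᵐ x ∂ν, 0 < q x) :
    (ν.withDensity fun x => ENNReal.ofReal (p x)).rnDeriv
        (ν.withDensity fun x => ENNReal.ofReal (q x))
      =ᵐ[ν.withDensity fun x => ENNReal.ofReal (q x)] fun x => ENNReal.ofReal (p x / q x) := by
  rw [withDensity_ofReal_eq_withDensity_div hp hq hq0]
  exact Measure.rnDeriv_withDensity _ (hp.div hq).ennreal_ofReal

lemma withDensity_absolutelyContinuous_withDensity (hp : Measurable p) (hq : Measurable q)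
    (hq0 : ∀ᵐ x ∂ν, 0 < q x) :
    (ν.withDensity fun x => ENNReal.ofReal (p x)) ≪
      ν.withDensity fun x => ENNReal.ofReal (q x) := by
  rw [withDensity_ofReal_eq_withDensity_div hp hq hq0]
  exact withDensity_absolutelyContinuous _ _

lemma llr_withDensity_withDensity
    [SigmaFinite (ν.withDensity fun x => ENNReal.ofReal (q x))]
    (hp : Measurable p) (hq : Measurable q) (hp0 : ∀ᵐ x ∂ν, 0 < p x) (hq0 : ∀ᵐ x ∂ν, 0 < q x) :
    llr (ν.withDensity fun x => ENNReal.ofReal (p x))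
        (ν.withDensity fun x => ENNReal.ofReal (q x))
      =ᵐ[ν.withDensity fun x => ENNReal.ofReal (p x)] fun x => Real.log (p x) - Real.log (q x) := by
  filter_upwards [(withDensity_absolutelyContinuous_withDensity hp hq hq0).ae_le
    (rnDeriv_withDensity_withDensity hp hq hq0),
    (withDensity_absolutelyContinuous ν _).ae_le hp0,
    (withDensity_absolutelyContinuous ν _).ae_le hq0] with x h1 h2 h3
  rw [llr, h1, ENNReal.toReal_ofReal (div_pos h2 h3).le, Real.log_div h2.ne' h3.ne']

end WithDensity

/-! ### The joint law -/

section Joint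

variable {ρ : Measure ℝ} {k : ℕ} {μ : Fin k → ℝ}

lemma jointDensity_pos (μ x : Fin k → ℝ) : 0 < jointDensity ρ μ x :=
  Finset.prod_pos fun i _ => density_pos (μ i) (x i)

@[fun_prop]
lemma measurable_jointDensity (μ : Fin k → ℝ) : Measurable (jointDensity ρ μ) := by
  unfold jointDensity
  fun_prop

@[fun_prop]
lemma measurable_sumStat : Measurable (sumStat (k := k)) := by
  unfold sumStat
  fun_prop

lemma log_jointDensity (μ x : Fin k → ℝ) :
    Real.log (jointDensity ρ μ x)
      = ∑ i, (canonicalParam ρ (μ i) * x i - meanLogNormalizer ρ (μ i)) := by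
  rw [jointDensity, Real.log_prod fun i _ => (density_pos (μ i) (x i)).ne']
  simp_rw [log_density]

lemma jointDensity_eq_exp (μ x : Fin k → ℝ) :
    jointDensity ρ μ x
      = Real.exp (∑ i, (canonicalParam ρ (μ i) * x i - meanLogNormalizer ρ (μ i))) := by
  rw [← log_jointDensity, Real.exp_log (jointDensity_pos μ x)]

/-- The density of `P_⟨m⟩` depends on the block through its sum only. -/
lemma jointDensity_rep (m : ℝ) (x : Fin k → ℝ) :
    jointDensity ρ (rep k m) x
      = Real.exp (canonicalParam ρ m * sumStat x - k * meanLogNormalizer ρ m) := by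
  rw [jointDensity_eq_exp]
  simp [rep, sumStat, Finset.mul_sum]

variable [IsProbabilityMeasure ρ]

lemma integrable_density {m : ℝ} (hm : m ∈ meanSpace ρ) : Integrable (density ρ m) ρ := by
  have h : Integrable (fun x : ℝ => Real.exp (canonicalParam ρ m * id x)) ρ :=
    canonicalParam_mem hm
  refine (h.div_const (mgf id ρ (canonicalParam ρ m))).congr (ae_of_all _ fun x => ?_)
  exact (exp_sub_logNormalizer (canonicalParam_mem hm) x).symm

lemma integrable_jointDensity (hμ : ∀ i, μ i ∈ meanSpace ρ) :
    Integrable (jointDensity ρ μ) (Measure.pi fun _ => ρ) :=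
  Integrable.fintype_prod fun i => integrable_density (hμ i)

lemma jointLaw_eq_withDensity (hμ : ∀ i, μ i ∈ meanSpace ρ) :
    jointLaw ρ μ
      = (Measure.pi fun _ => ρ).withDensity fun x => ENNReal.ofReal (jointDensity ρ μ x) := by
  have (i : Fin k) : IsProbabilityMeasure (law ρ (μ i)) := isProbabilityMeasure_law (hμ i)
  refine Measure.pi_eq fun s hs => ?_
  rw [withDensity_apply _ (MeasurableSet.univ_pi hs), Measure.restrict_pi_pi,
    ← ofReal_integral_eq_lintegral_ofReal]
  · simp_rw [jointDensity]
    rw [integral_fintype_prod_eq_prod, ENNReal.ofReal_prod_of_nonneg]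
    · refine Finset.prod_congr rfl fun i _ => ?_
      rw [law, withDensity_apply _ (hs i), ofReal_integral_eq_lintegral_ofReal]
      · exact (integrable_density (hμ i)).restrict
      · exact ae_of_all _ fun x => (density_pos _ x).le
    · exact fun i _ => integral_nonneg fun x => (density_pos _ x).le
  · exact Integrable.fintype_prod fun i => (integrable_density (hμ i)).restrict
  · exact ae_of_all _ fun x => (jointDensity_pos _ x).le

lemma isProbabilityMeasure_jointLaw (hμ : ∀ i, μ i ∈ meanSpace ρ) :
    IsProbabilityMeasure (jointLaw ρ μ) := by
  have (i : Fin k) : IsProbabilityMeasure (law ρ (μ i)) := isProbabilityMeasure_law (hμ i)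
  unfold jointLaw
  infer_instance

lemma isProbabilityMeasure_sumLaw (hμ : ∀ i, μ i ∈ meanSpace ρ) :
    IsProbabilityMeasure (sumLaw ρ μ) := by
  have := isProbabilityMeasure_jointLaw hμ
  exact Measure.isProbabilityMeasure_map measurable_sumStat.aemeasurable

lemma IsRegularFamily.integrable_eval_jointLaw (hρ : IsRegularFamily ρ)
    (hμ : ∀ i, μ i ∈ meanSpace ρ) (i : Fin k) : Integrable (fun x => x i) (jointLaw ρ μ) := by
  have (i : Fin k) : IsProbabilityMeasure (law ρ (μ i)) := isProbabilityMeasure_law (hμ i)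
  refine integrable_comp_eval (X := fun _ : Fin k => ℝ) (f := fun y : ℝ => y) ?_
  rw [law_eq_tilted (hμ i)]
  have := memLp_tilted_mul (hρ.mem_interior (canonicalParam_mem (hμ i))) 1
  exact (memLp_one_iff_integrable (f := id)).1 (by simpa using this)

lemma IsRegularFamily.integrable_log_jointDensity (hρ : IsRegularFamily ρ)
    (hμ : ∀ i, μ i ∈ meanSpace ρ) (μ' : Fin k → ℝ) :
    Integrable (fun x => Real.log (jointDensity ρ μ' x)) (jointLaw ρ μ) := by
  have := isProbabilityMeasure_jointLaw hμ
  simp_rw [log_jointDensity]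
  exact integrable_finsetSum _ fun i _ =>
    ((hρ.integrable_eval_jointLaw hμ i).const_mul _).sub (integrable_const _)

/-! ### The disintegration along the sum -/

instance : IsMarkovKernel (fiber ρ k) := by
  unfold fiber
  infer_instance

instance : IsProbabilityMeasure (sumBase ρ k) :=
  Measure.isProbabilityMeasure_map measurable_sumStat.aemeasurable

variable (ρ k) in
lemma sumBase_compProd_fiber :
    sumBase ρ k ⊗ₘ fiber ρ k = (Measure.pi fun _ => ρ).map fun x => (sumStat x, x) :=
  compProd_map_condDistrib aemeasurable_id

variable (ρ k) in
lemma ae_fiber_sumStat_eq : ∀ᵐ z ∂(sumBase ρ k), ∀ᵐ x ∂(fiber ρ k z), sumStat x = z := by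
  have h : ∀ᵐ y ∂(sumBase ρ k ⊗ₘ fiber ρ k), sumStat y.2 = y.1 := by
    rw [sumBase_compProd_fiber, ae_map_iff (by fun_prop)]
    · simp
    · exact measurableSet_eq_fun (by fun_prop) (by fun_prop)
  exact Measure.ae_ae_of_ae_compProd h

lemma measurable_integral_fiber {φ : (Fin k → ℝ) → ℝ} (hφ : Measurable φ) :
    Measurable fun z => ∫ x, φ x ∂(fiber ρ k z) :=
  (StronglyMeasurable.integral_condDistrib (X := sumStat) (Y := id)
    (μ := Measure.pi fun _ : Fin k => ρ) (f := fun y : ℝ × (Fin k → ℝ) => φ y.2)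
    (hφ.comp measurable_snd).stronglyMeasurable).measurable

lemma measurable_sumDensity (μ : Fin k → ℝ) : Measurable (sumDensity ρ μ) :=
  measurable_integral_fiber (measurable_jointDensity μ)

variable {φ : (Fin k → ℝ) → ℝ}

lemma ae_integrable_fiber (hφ : Integrable φ (Measure.pi fun _ => ρ)) :
    ∀ᵐ z ∂(sumBase ρ k), Integrable φ (fiber ρ k z) :=
  Integrable.condDistrib_ae_map (Y := id) (f := fun y : ℝ × (Fin k → ℝ) => φ y.2)
    aemeasurable_id (hφ.comp_snd_map_prodMk sumStat)

lemma integrable_integral_fiber (hφ : Integrable φ (Measure.pi fun _ => ρ)) :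
    Integrable (fun z => ∫ x, φ x ∂(fiber ρ k z)) (sumBase ρ k) :=
  Integrable.integral_condDistrib_map (Y := id) (f := fun y : ℝ × (Fin k → ℝ) => φ y.2)
    aemeasurable_id (hφ.comp_snd_map_prodMk sumStat)

/-- The fiber integral is a version of the conditional expectation given `Z`. Both the density of
`Z` and the exchangeability argument rest on this identity. -/
lemma setIntegral_integral_fiber (hφ : Integrable φ (Measure.pi fun _ => ρ))
    (hm : Measurable φ) {s : Set ℝ} (hs : MeasurableSet s) :
    ∫ z in s, ∫ x, φ x ∂(fiber ρ k z) ∂(sumBase ρ k)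
      = ∫ x in sumStat ⁻¹' s, φ x ∂(Measure.pi fun _ => ρ) := by
  have hint : Integrable (fun y : ℝ × (Fin k → ℝ) => φ y.2) (sumBase ρ k ⊗ₘ fiber ρ k) := by
    rw [sumBase_compProd_fiber]
    exact hφ.comp_snd_map_prodMk sumStat
  have hm' : Measurable fun y : ℝ × (Fin k → ℝ) => φ y.2 := hm.comp measurable_snd
  have h := Measure.setIntegral_compProd hs MeasurableSet.univ hint.integrableOn
  simp only [Measure.restrict_univ] at h
  rw [← h, sumBase_compProd_fiber, setIntegral_map (hs.prod MeasurableSet.univ)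
    hm'.aestronglyMeasurable (by fun_prop)]
  congr 2
  ext x
  simp

lemma map_sumStat_withDensity (hφ : Integrable φ (Measure.pi fun _ => ρ)) (hm : Measurable φ)
    (h0 : ∀ x, 0 ≤ φ x) :
    ((Measure.pi fun _ => ρ).withDensity fun x => ENNReal.ofReal (φ x)).map sumStat
      = (sumBase ρ k).withDensity fun z => ENNReal.ofReal (∫ x, φ x ∂(fiber ρ k z)) := by
  ext s hs
  rw [Measure.map_apply measurable_sumStat hs, withDensity_apply _ (measurable_sumStat hs),
    withDensity_apply _ hs, ← ofReal_integral_eq_lintegral_ofReal hφ.restrict (ae_of_all _ h0),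
    ← ofReal_integral_eq_lintegral_ofReal (integrable_integral_fiber hφ).restrict
      (ae_of_all _ fun z => integral_nonneg h0), setIntegral_integral_fiber hφ hm hs]

lemma sumLaw_eq_withDensity (hμ : ∀ i, μ i ∈ meanSpace ρ) :
    sumLaw ρ μ = (sumBase ρ k).withDensity fun z => ENNReal.ofReal (sumDensity ρ μ z) := by
  rw [sumLaw, jointLaw_eq_withDensity hμ]
  exact map_sumStat_withDensity (integrable_jointDensity hμ) (measurable_jointDensity μ)
    fun x => (jointDensity_pos μ x).le

/-- A strictly positive function has a positive integral against a probability measure.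
Integrability on the fiber matters here: without it the integral would default to `0`. -/
lemma ae_sumDensity_pos (hμ : ∀ i, μ i ∈ meanSpace ρ) :
    ∀ᵐ z ∂(sumBase ρ k), 0 < sumDensity ρ μ z := by
  filter_upwards [ae_integrable_fiber (integrable_jointDensity hμ)] with z hz
  rw [sumDensity, integral_pos_iff_support_of_nonneg (fun x => (jointDensity_pos μ x).le) hz,
    Function.support_eq_univ (fun x => (jointDensity_pos μ x).ne'), measure_univ]
  exact one_pos

variable (k) in
/-- Under the base measure the block is exchangeable given its sum. -/
lemma ae_integral_fiber_eval_eq (hint : Integrable id ρ) (i j : Fin k) :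
    ∀ᵐ z ∂(sumBase ρ k), ∫ x, x i ∂(fiber ρ k z) = ∫ x, x j ∂(fiber ρ k z) := by
  have hev (i : Fin k) : Integrable (fun x : Fin k → ℝ => x i) (Measure.pi fun _ => ρ) :=
    integrable_comp_eval (X := fun _ : Fin k => ℝ) (f := fun y : ℝ => y) hint
  refine Integrable.ae_eq_of_forall_setIntegral_eq _ _ (integrable_integral_fiber (hev i))
    (integrable_integral_fiber (hev j)) fun s hs _ => ?_
  rw [setIntegral_integral_fiber (hev i) (measurable_pi_apply i) hs,
    setIntegral_integral_fiber (hev j) (measurable_pi_apply j) hs]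
  -- Exchanging the coordinates `i` and `j` preserves both `ρ^k` and the sum, hence every event `Z ∈
  -- s`.
  set T := MeasurableEquiv.piCongrLeft (fun _ : Fin k => ℝ) (Equiv.swap i j) with hT
  have hT' : ∀ x l, T x (Equiv.swap i j l) = x l := fun x l =>
    Equiv.piCongrLeft_apply_apply (fun _ : Fin k => ℝ) (Equiv.swap i j) x l
  have hsum : ∀ x, sumStat (T x) = sumStat x := fun x => by
    rw [sumStat, ← Equiv.sum_comp (Equiv.swap i j)]
    simp_rw [hT']
    rfl
  have hTp := measurePreserving_piCongrLeft (fun _ : Fin k => ρ) (Equiv.swap i j)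
  have := hTp.setIntegral_preimage_emb T.measurableEmbedding (fun x => x j) (sumStat ⁻¹' s)
  rw [← this]
  have hpre : T ⁻¹' (sumStat ⁻¹' s) = sumStat ⁻¹' s := by
    ext x
    simp [hsum]
  rw [hpre]
  refine integral_congr_ae (ae_of_all _ fun x => ?_)
  have := hT' x i
  rw [Equiv.swap_apply_left] at this
  exact this.symm

/-! ### Growth rate difference and Kullback-Leibler divergence -/

variable {m : ℝ}

lemma jointLaw_absolutelyContinuous (hμ : ∀ i, μ i ∈ meanSpace ρ)
    (hm : m ∈ meanSpace ρ) : jointLaw ρ μ ≪ jointLaw ρ (rep k m) := by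
  rw [jointLaw_eq_withDensity hμ, jointLaw_eq_withDensity (μ := rep k m) fun _ => hm]
  exact withDensity_absolutelyContinuous_withDensity (measurable_jointDensity _)
    (measurable_jointDensity _) (ae_of_all _ fun x => jointDensity_pos _ x)

/-- Log-densities are affine in the block, and every coordinate has a first moment. -/
lemma IsRegularFamily.integrable_llr_jointLaw (hρ : IsRegularFamily ρ)
    (hμ : ∀ i, μ i ∈ meanSpace ρ) (hm : m ∈ meanSpace ρ) :
    Integrable (llr (jointLaw ρ μ) (jointLaw ρ (rep k m))) (jointLaw ρ μ) := by
  refine ((hρ.integrable_log_jointDensity hμ μ).sub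
    (hρ.integrable_log_jointDensity hμ (rep k m))).congr ?_
  have := isProbabilityMeasure_jointLaw (μ := rep k m) fun _ => hm
  rw [jointLaw_eq_withDensity (μ := rep k m) fun _ => hm] at this ⊢
  rw [jointLaw_eq_withDensity hμ]
  exact (llr_withDensity_withDensity (measurable_jointDensity _)
    (measurable_jointDensity _) (ae_of_all _ fun x => jointDensity_pos _ x)
    (ae_of_all _ fun x => jointDensity_pos _ x)).symm

/-- Integrability of the log-likelihood ratio passes to image measures, so no estimate of the
density of `Z` is needed. This holds for all admissible `δ`, not only small ones. -/
lemma IsRegularFamily.integrable_llr_sumLaw (hρ : IsRegularFamily ρ)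
    (hμ : ∀ i, μ i ∈ meanSpace ρ) (hm : m ∈ meanSpace ρ) :
    Integrable (llr (sumLaw ρ μ) (sumLaw ρ (rep k m))) (sumLaw ρ μ) := by
  have := isProbabilityMeasure_jointLaw hμ
  have := isProbabilityMeasure_jointLaw (μ := rep k m) fun _ => hm
  exact integrable_llr_map (jointLaw_absolutelyContinuous hμ hm)
    measurable_sumStat (hρ.integrable_llr_jointLaw hμ hm)

lemma sumLaw_absolutelyContinuous (hμ : ∀ i, μ i ∈ meanSpace ρ) (hm : m ∈ meanSpace ρ) :
    sumLaw ρ μ ≪ sumLaw ρ (rep k m) :=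
  (jointLaw_absolutelyContinuous hμ hm).map measurable_sumStat

/-- On blocks, the difference of the two log-ratios is the log-likelihood ratio of the sum. -/
lemma logDiff_ae_eq_llr (hμ : ∀ i, μ i ∈ meanSpace ρ) (hm : m ∈ meanSpace ρ)
    (hmean : (1 / (k : ℝ)) * ∑ i, μ i = m) :
    logDiff ρ m μ =ᵐ[jointLaw ρ μ]
      fun x => llr (sumLaw ρ μ) (sumLaw ρ (rep k m)) (sumStat x) := by
  have hpos := ae_sumDensity_pos hμ
  have hpos₀ := ae_sumDensity_pos (μ := rep k m) fun _ => hm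
  have hllr : llr (sumLaw ρ μ) (sumLaw ρ (rep k m)) =ᵐ[sumLaw ρ μ]
      fun z => Real.log (sumDensity ρ μ z) - Real.log (sumDensity ρ (rep k m) z) := by
    have := isProbabilityMeasure_sumLaw (μ := rep k m) fun _ => hm
    rw [sumLaw_eq_withDensity (μ := rep k m) fun _ => hm] at this ⊢
    rw [sumLaw_eq_withDensity hμ]
    exact llr_withDensity_withDensity (measurable_sumDensity _) (measurable_sumDensity _)
      hpos hpos₀
  have hac : sumLaw ρ μ ≪ sumBase ρ k := by
    rw [sumLaw_eq_withDensity hμ]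
    exact withDensity_absolutelyContinuous _ _
  have hst : AEMeasurable (sumStat (k := k)) (jointLaw ρ μ) := measurable_sumStat.aemeasurable
  filter_upwards [ae_of_ae_map hst hllr, ae_of_ae_map hst (hac.ae_le hpos),
    ae_of_ae_map hst (hac.ae_le hpos₀)] with x h1 h2 h3
  have hj := jointDensity_pos (ρ := ρ) μ x
  have hj₀ := jointDensity_pos (ρ := ρ) (rep k m) x
  rw [h1, logDiff, Spseudo, hmean, Scond, condDensity, condDensity,
    Real.log_div hj.ne' hj₀.ne', Real.log_div (div_pos hj h2).ne' (div_pos hj₀ h3).ne',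
    Real.log_div hj.ne' h2.ne', Real.log_div hj₀.ne' h3.ne']
  ring

lemma IsRegularFamily.integrable_logDiff (hρ : IsRegularFamily ρ)
    (hμ : ∀ i, μ i ∈ meanSpace ρ) (hm : m ∈ meanSpace ρ)
    (hmean : (1 / (k : ℝ)) * ∑ i, μ i = m) : Integrable (logDiff ρ m μ) (jointLaw ρ μ) := by
  refine Integrable.congr ?_ (logDiff_ae_eq_llr hμ hm hmean).symm
  exact (hρ.integrable_llr_sumLaw hμ hm).comp_measurable measurable_sumStat

lemma IsRegularFamily.klDiv_sumLaw_ne_top (hρ : IsRegularFamily ρ)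
    (hμ : ∀ i, μ i ∈ meanSpace ρ) (hm : m ∈ meanSpace ρ) :
    klDiv (sumLaw ρ μ) (sumLaw ρ (rep k m)) ≠ ⊤ :=
  klDiv_ne_top (sumLaw_absolutelyContinuous hμ hm) (hρ.integrable_llr_sumLaw hμ hm)

lemma integral_logDiff (hμ : ∀ i, μ i ∈ meanSpace ρ) (hm : m ∈ meanSpace ρ)
    (hmean : (1 / (k : ℝ)) * ∑ i, μ i = m) :
    ∫ x, logDiff ρ m μ x ∂(jointLaw ρ μ)
      = (klDiv (sumLaw ρ μ) (sumLaw ρ (rep k m))).toReal := by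
  have := isProbabilityMeasure_sumLaw hμ
  have := isProbabilityMeasure_sumLaw (μ := rep k m) fun _ => hm
  rw [toReal_klDiv_of_measure_eq (sumLaw_absolutelyContinuous hμ hm) (by simp),
    integral_congr_ae (logDiff_ae_eq_llr hμ hm hmean)]
  exact (integral_map measurable_sumStat.aemeasurable
    (stronglyMeasurable_llr _ _).aestronglyMeasurable).symm

/-- The divergence as the integral of `klFun` of the density ratio. -/
lemma toReal_klDiv_sumLaw (hμ : ∀ i, μ i ∈ meanSpace ρ) (hm : m ∈ meanSpace ρ) :
    (klDiv (sumLaw ρ μ) (sumLaw ρ (rep k m))).toReal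
      = ∫ z, klFun (sumDensity ρ μ z / sumDensity ρ (rep k m) z) ∂(sumLaw ρ (rep k m)) := by
  have := isProbabilityMeasure_sumLaw hμ
  have hQ := isProbabilityMeasure_sumLaw (μ := rep k m) fun _ => hm
  rw [toReal_klDiv_eq_integral_klFun (sumLaw_absolutelyContinuous hμ hm)]
  have hrn : (sumLaw ρ μ).rnDeriv (sumLaw ρ (rep k m)) =ᵐ[sumLaw ρ (rep k m)]
      fun z => ENNReal.ofReal (sumDensity ρ μ z / sumDensity ρ (rep k m) z) := by
    rw [sumLaw_eq_withDensity (μ := rep k m) fun _ => hm] at hQ ⊢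
    rw [sumLaw_eq_withDensity hμ]
    exact rnDeriv_withDensity_withDensity (measurable_sumDensity _) (measurable_sumDensity _)
      (ae_sumDensity_pos fun _ => hm)
  refine integral_congr_ae ?_
  filter_upwards [hrn] with z hz
  rw [hz, ENNReal.toReal_ofReal]
  exact div_nonneg (integral_nonneg fun x => (jointDensity_pos _ x).le)
    (integral_nonneg fun x => (jointDensity_pos _ x).le)

end Joint

/-! ### Derivatives of an exponential -/

/-- The first complete Bell polynomials in the derivatives `h 1`, `h 2`, `h 3`. -/
def bellPoly (h : ℕ → ℝ) : ℕ → ℝ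
  | 0 => 1
  | 1 => h 1
  | 2 => h 1 ^ 2 + h 2
  | _ => h 1 ^ 3 + 3 * h 1 * h 2 + h 3

/-- The constant `c` will be the log-density at `δ = 0`, so that the exponential is a density ratio.
-/
lemma hasDerivAt_bellPoly_mul_exp {h : ℕ → ℝ → ℝ} {x : ℝ} (c : ℝ)
    (hh : ∀ j, HasDerivAt (h j) (h (j + 1) x) x) {j : ℕ} (hj : j < 3) :
    HasDerivAt (fun y => bellPoly (h · y) j * Real.exp (h 0 y - c))
      (bellPoly (h · x) (j + 1) * Real.exp (h 0 x - c)) x := by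
  have he := ((hh 0).sub_const c).exp
  interval_cases j
  · simpa [bellPoly, mul_comm] using he
  · refine ((hh 1).mul he).congr_deriv ?_
    simp only [bellPoly]
    ring
  · refine ((((hh 1).fun_pow 2).add (hh 2)).mul he).congr_deriv ?_
    simp only [bellPoly, Pi.add_apply]
    ring

lemma abs_bellPoly_le {h : ℕ → ℝ} {T : ℝ} (hT : 1 ≤ T)
    (hh : ∀ j, 1 ≤ j → j ≤ 3 → |h j| ≤ T) {j : ℕ} (hj : j ≤ 3) : |bellPoly h j| ≤ 5 * T ^ 3 := by
  have h1 := hh 1 le_rfl (by lia)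
  have h2 := hh 2 (by lia) (by lia)
  have h3 := hh 3 (by lia) le_rfl
  have e1 : T ≤ T ^ 3 := le_self_pow₀ hT (by lia)
  have e2 : T ^ 2 ≤ T ^ 3 := pow_le_pow_right₀ hT (by lia)
  have a2 : |h 1 ^ 2| ≤ T ^ 2 := by rw [abs_pow]; gcongr
  have a3 : |h 1 ^ 3| ≤ T ^ 3 := by rw [abs_pow]; gcongr
  have a12 : |h 1 * h 2| ≤ T * T := by rw [abs_mul]; gcongr
  interval_cases j
  · simp only [bellPoly, abs_one]; linarith
  · simp only [bellPoly]; linarith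
  · simp only [bellPoly]
    refine (abs_add_le _ _).trans ?_
    linarith
  · simp only [bellPoly]
    rw [abs_le] at *
    constructor <;> nlinarith

lemma hasDerivAt_iteratedDeriv_of_analyticAt {f : ℝ → ℝ} {m : ℝ} (hf : AnalyticAt ℝ f m) (j : ℕ) :
    HasDerivAt (iteratedDeriv j f) (iteratedDeriv (j + 1) f m) m := by
  have : AnalyticAt ℝ (iteratedDeriv j f) m := by
    rw [iteratedDeriv_eq_iterate]
    exact hf.iterated_deriv j
  rw [iteratedDeriv_succ]
  exact this.differentiableAt.hasDerivAt

/-! ### The path of joint densities -/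

section Path

variable {ρ : Measure ℝ} {k : ℕ} {μ₀ : ℝ} {α : Fin k → ℝ}

/-- The `j`-th derivative in `δ` of the joint log-density at `⟨μ₀⟩ + δ α`. -/
noncomputable def logPath (ρ : Measure ℝ) (μ₀ : ℝ) (α : Fin k → ℝ) (j : ℕ) (δ : ℝ)
    (x : Fin k → ℝ) : ℝ :=
  ∑ i, α i ^ j * (iteratedDeriv j (canonicalParam ρ) (μ₀ + δ * α i) * x i
    - iteratedDeriv j (meanLogNormalizer ρ) (μ₀ + δ * α i))

/-- The `j`-th derivative in `δ` of `p_{⟨μ₀⟩ + δ α} / p_⟨μ₀⟩`, for `j ≤ 3`. -/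
noncomputable def ratioPath (ρ : Measure ℝ) (μ₀ : ℝ) (α : Fin k → ℝ) (j : ℕ) (δ : ℝ)
    (x : Fin k → ℝ) : ℝ :=
  bellPoly (logPath ρ μ₀ α · δ x) j * Real.exp (logPath ρ μ₀ α 0 δ x - logPath ρ μ₀ α 0 0 x)

@[fun_prop]
lemma measurable_logPath (j : ℕ) (δ : ℝ) : Measurable (logPath ρ μ₀ α j δ) := by
  unfold logPath
  fun_prop

lemma measurable_ratioPath {j : ℕ} (hj : j ≤ 3) (δ : ℝ) : Measurable (ratioPath ρ μ₀ α j δ) := by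
  unfold ratioPath
  interval_cases j <;> simp only [bellPoly] <;> fun_prop

lemma shifted_apply (δ : ℝ) (i : Fin k) : shifted μ₀ α δ i = μ₀ + δ * α i := rfl

lemma shifted_zero : shifted μ₀ α 0 = rep k μ₀ := by
  simp [shifted]

lemma jointDensity_shifted (δ : ℝ) (x : Fin k → ℝ) :
    jointDensity ρ (shifted μ₀ α δ) x = Real.exp (logPath ρ μ₀ α 0 δ x) := by
  simp [jointDensity_eq_exp, logPath, shifted_apply]

lemma jointDensity_shifted_eq_mul (δ : ℝ) (x : Fin k → ℝ) :
    jointDensity ρ (shifted μ₀ α δ) x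
      = jointDensity ρ (rep k μ₀) x * ratioPath ρ μ₀ α 0 δ x := by
  rw [← shifted_zero (α := α), jointDensity_shifted, jointDensity_shifted, ratioPath, bellPoly,
    one_mul, ← Real.exp_add]
  ring_nf

lemma ratioPath_zero_zero (x : Fin k → ℝ) : ratioPath ρ μ₀ α 0 0 x = 1 := by
  simp [ratioPath, bellPoly]

/-- Openness of the canonical space leaves room on both sides of `λ(μ₀)`, and `exp (s |x|) ≤ exp (s
x) + exp (-s x)`. -/
lemma IsRegularFamily.exists_integrable_density_mul_exp (hρ : IsRegularFamily ρ)
    (hμ₀ : μ₀ ∈ meanSpace ρ) :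
    ∃ t > 0, ∀ s, |s| < t → Integrable (fun x => density ρ μ₀ x * Real.exp (s * |x|)) ρ := by
  obtain ⟨t, ht, hball⟩ := Metric.isOpen_iff.1 hρ.isOpen_canonicalSpace _ (canonicalParam_mem hμ₀)
  have hmem (s : ℝ) (hs : |s| < t) :
      Integrable (fun x : ℝ => Real.exp ((canonicalParam ρ μ₀ + s) * x)) ρ :=
    hball (a := canonicalParam ρ μ₀ + s) (by simpa [Real.dist_eq] using hs)
  refine ⟨t, ht, fun s hs => ?_⟩
  have h1 := hmem s hs
  have h2 := hmem (-s) (by rwa [abs_neg])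
  refine ((integrable_exp_mul_abs_add (X := fun x : ℝ => x) h1 h2).mul_const
    (Real.exp (-logNormalizer ρ (canonicalParam ρ μ₀)))).congr (ae_of_all _ fun x => ?_)
  simp only [density, ← Real.exp_add]
  ring_nf

variable [IsProbabilityMeasure ρ]

lemma IsRegularFamily.hasDerivAt_logPath (hρ : IsRegularFamily ρ) {δ : ℝ}
    (hδ : ∀ i, μ₀ + δ * α i ∈ meanSpace ρ) (j : ℕ) (x : Fin k → ℝ) :
    HasDerivAt (logPath ρ μ₀ α j · x) (logPath ρ μ₀ α (j + 1) δ x) δ := by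
  unfold logPath
  refine HasDerivAt.fun_sum fun i _ => ?_
  have haff : HasDerivAt (fun y : ℝ => μ₀ + y * α i) (α i) δ := by
    simpa using ((hasDerivAt_id δ).mul_const (α i)).const_add μ₀
  have h1 := (hasDerivAt_iteratedDeriv_of_analyticAt (hρ.analyticAt_canonicalParam (hδ i)) j).comp
    δ haff
  have h2 := (hasDerivAt_iteratedDeriv_of_analyticAt (hρ.analyticAt_meanLogNormalizer (hδ i)) j).comp
    δ haff
  refine (((h1.mul_const (x i)).sub h2).const_mul (α i ^ j)).congr_deriv ?_
  ring

lemma IsRegularFamily.hasDerivAt_ratioPath (hρ : IsRegularFamily ρ) {δ : ℝ}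
    (hδ : ∀ i, μ₀ + δ * α i ∈ meanSpace ρ) {j : ℕ} (hj : j < 3) (x : Fin k → ℝ) :
    HasDerivAt (ratioPath ρ μ₀ α j · x) (ratioPath ρ μ₀ α (j + 1) δ x) δ :=
  hasDerivAt_bellPoly_mul_exp (h := fun j δ => logPath ρ μ₀ α j δ x) _
    (fun j => hρ.hasDerivAt_logPath hδ j x) hj

lemma IsRegularFamily.continuousAt_ratioPath (hρ : IsRegularFamily ρ) {δ : ℝ}
    (hδ : ∀ i, μ₀ + δ * α i ∈ meanSpace ρ) (x : Fin k → ℝ) :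
    ContinuousAt (ratioPath ρ μ₀ α 3 · x) δ := by
  have h (j : ℕ) : ContinuousAt (logPath ρ μ₀ α j · x) δ :=
    (hρ.hasDerivAt_logPath hδ j x).continuousAt
  have h0 := h 0
  have h1 := h 1
  have h2 := h 2
  have h3 := h 3
  simp only [ratioPath, bellPoly]
  fun_prop

lemma IsRegularFamily.logPath_one_zero (hρ : IsRegularFamily ρ) (hμ₀ : μ₀ ∈ meanSpace ρ)
    (x : Fin k → ℝ) :
    logPath ρ μ₀ α 1 0 x = fisherInfo ρ μ₀ * ∑ i, α i * (x i - μ₀) := by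
  simp only [logPath, iteratedDeriv_one, zero_mul, add_zero, hρ.fisherInfo_eq hμ₀,
    hρ.deriv_meanLogNormalizer hμ₀, Finset.mul_sum]
  exact Finset.sum_congr rfl fun i _ => by ring

lemma IsRegularFamily.logPath_two_zero (hρ : IsRegularFamily ρ) (hμ₀ : μ₀ ∈ meanSpace ρ)
    (x : Fin k → ℝ) :
    logPath ρ μ₀ α 2 0 x
      = ∑ i, α i ^ 2 * (deriv (fisherInfo ρ) μ₀ * (x i - μ₀) - fisherInfo ρ μ₀) := by
  have h2 (f : ℝ → ℝ) : iteratedDeriv 2 f = deriv (deriv f) := by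
    rw [iteratedDeriv_succ, iteratedDeriv_one]
  simp only [logPath, h2, zero_mul, add_zero, hρ.fisherInfo_eq hμ₀,
    (hρ.fisherInfo_eventuallyEq hμ₀).deriv_eq, hρ.deriv_deriv_meanLogNormalizer hμ₀]
  exact Finset.sum_congr rfl fun i _ => by ring

lemma IsRegularFamily.ratioPath_one_zero (hρ : IsRegularFamily ρ) (hμ₀ : μ₀ ∈ meanSpace ρ)
    (x : Fin k → ℝ) :
    ratioPath ρ μ₀ α 1 0 x = fisherInfo ρ μ₀ * ∑ i, α i * (x i - μ₀) := by
  simp [ratioPath, bellPoly, hρ.logPath_one_zero hμ₀]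

lemma IsRegularFamily.jointDensity_mul_ratioPath_two_zero (hρ : IsRegularFamily ρ)
    (hμ₀ : μ₀ ∈ meanSpace ρ) (x : Fin k → ℝ) :
    jointDensity ρ (rep k μ₀) x * ratioPath ρ μ₀ α 2 0 x = secondDerivIntegrand ρ μ₀ α x := by
  simp only [ratioPath, bellPoly, sub_self, Real.exp_zero, mul_one, secondDerivIntegrand,
    hρ.logPath_one_zero hμ₀, hρ.logPath_two_zero hμ₀, mul_pow]

/-! ### The envelope -/

/-- Near a mean value, `λ`, `A ∘ λ` are nearly constant and their derivatives are bounded. -/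
lemma IsRegularFamily.exists_bounds (hρ : IsRegularFamily ρ) (hμ₀ : μ₀ ∈ meanSpace ρ) {ε : ℝ}
    (hε : 0 < ε) : ∃ r > 0, ∃ K ≥ 1, ∀ m, |m - μ₀| < r → m ∈ meanSpace ρ ∧
      |canonicalParam ρ m - canonicalParam ρ μ₀| ≤ ε ∧
      |meanLogNormalizer ρ m - meanLogNormalizer ρ μ₀| ≤ ε ∧
      ∀ j ≤ 3, |iteratedDeriv j (canonicalParam ρ) m| ≤ K ∧
        |iteratedDeriv j (meanLogNormalizer ρ) m| ≤ K := by
  have han := hρ.analyticAt_canonicalParam hμ₀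
  have han' := hρ.analyticAt_meanLogNormalizer hμ₀
  have hnear {f : ℝ → ℝ} (hf : AnalyticAt ℝ f μ₀) : ∀ᶠ m in 𝓝 μ₀, |f m - f μ₀| ≤ ε := by
    filter_upwards [Metric.tendsto_nhds.1 hf.continuousAt.tendsto ε hε] with m hm
    exact hm.le
  have hbdd {f : ℝ → ℝ} (hf : AnalyticAt ℝ f μ₀) (j : ℕ) :
      ∀ᶠ m in 𝓝 μ₀, |iteratedDeriv j f m| ≤ |iteratedDeriv j f μ₀| + 1 := by
    have := (hasDerivAt_iteratedDeriv_of_analyticAt hf j).continuousAt.abs.tendsto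
    exact this.eventually_le_const (lt_add_one _)
  set K : ℝ := 1 + ∑ j ∈ Finset.range 4,
    (|iteratedDeriv j (canonicalParam ρ) μ₀| + |iteratedDeriv j (meanLogNormalizer ρ) μ₀|) with hK
  have hKj : ∀ j ≤ 3, |iteratedDeriv j (canonicalParam ρ) μ₀| + 1 ≤ K ∧
      |iteratedDeriv j (meanLogNormalizer ρ) μ₀| + 1 ≤ K := by
    intro j hj
    have := Finset.single_le_sum (f := fun j => |iteratedDeriv j (canonicalParam ρ) μ₀|
      + |iteratedDeriv j (meanLogNormalizer ρ) μ₀|) (fun i _ => by positivity)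
      (Finset.mem_range.2 (Nat.lt_succ_of_le hj))
    have a1 := abs_nonneg (iteratedDeriv j (canonicalParam ρ) μ₀)
    have a2 := abs_nonneg (iteratedDeriv j (meanLogNormalizer ρ) μ₀)
    constructor <;> linarith
  have hall : ∀ᶠ m in 𝓝 μ₀, ∀ j ∈ Finset.range 4, |iteratedDeriv j (canonicalParam ρ) m| ≤ K ∧
      |iteratedDeriv j (meanLogNormalizer ρ) m| ≤ K := by
    rw [eventually_all_finset]
    intro j hj
    have hj' : j ≤ 3 := Nat.le_of_lt_succ (Finset.mem_range.1 hj)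
    filter_upwards [hbdd han j, hbdd han' j] with m h1 h2
    exact ⟨h1.trans (hKj j hj').1, h2.trans (hKj j hj').2⟩
  obtain ⟨r, hr, hball⟩ := Metric.eventually_nhds_iff.1
    ((hρ.isOpen_meanSpace.eventually_mem hμ₀).and ((hnear han).and ((hnear han').and hall)))
  refine ⟨r, hr, K, ?_, fun m hm => ?_⟩
  · have : 0 ≤ ∑ j ∈ Finset.range 4, (|iteratedDeriv j (canonicalParam ρ) μ₀|
      + |iteratedDeriv j (meanLogNormalizer ρ) μ₀|) := Finset.sum_nonneg fun i _ => by positivity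
    linarith
  · obtain ⟨h1, h2, h3, h4⟩ := hball (y := m) hm
    exact ⟨h1, h2, h3, fun j hj => h4 j (Finset.mem_range.2 (Nat.lt_succ_of_le hj))⟩

/-- The sum of the absolute values of the entries of a block. -/
def absSum (x : Fin k → ℝ) : ℝ := ∑ i, |x i|

/-- The function `C exp (t ∑ |x_i|)` that dominates the path of density ratios. -/
noncomputable def envelope (C t : ℝ) (x : Fin k → ℝ) : ℝ := C * Real.exp (t * absSum x)

@[fun_prop]
lemma measurable_envelope (C t : ℝ) : Measurable (envelope (k := k) C t) := by
  unfold envelope absSum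
  fun_prop

lemma absSum_nonneg (x : Fin k → ℝ) : 0 ≤ absSum x := Finset.sum_nonneg fun _ _ => abs_nonneg _

lemma one_le_envelope {C t : ℝ} (hC : 1 ≤ C) (ht : 0 ≤ t) (x : Fin k → ℝ) :
    1 ≤ envelope C t x := by
  have : 1 ≤ Real.exp (t * absSum x) := Real.one_le_exp (mul_nonneg ht (absSum_nonneg x))
  unfold envelope
  nlinarith

lemma abs_sum_mul_sub_le {a b : Fin k → ℝ} {c : ℝ} (ha : ∀ i, |a i| ≤ c) (hb : ∀ i, |b i| ≤ c)
    (x : Fin k → ℝ) : |∑ i, (a i * x i - b i)| ≤ c * (absSum x + k) := by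
  calc |∑ i, (a i * x i - b i)| ≤ ∑ i, |a i * x i - b i| := Finset.abs_sum_le_sum_abs _ _
    _ ≤ ∑ i, (c * |x i| + c) := by
      refine Finset.sum_le_sum fun i _ => (abs_sub _ _).trans ?_
      rw [abs_mul]
      exact add_le_add (mul_le_mul_of_nonneg_right (ha i) (abs_nonneg _)) (hb i)
    _ = c * (absSum x + k) := by
      rw [Finset.sum_add_distrib, ← Finset.mul_sum, absSum]
      simp
      ring

/-- The rate `2 ε` is spent in two halves: one bounds the exponential of the change in log-density,
the other absorbs the cubic growth of the Bell polynomials. -/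
lemma IsRegularFamily.exists_envelope (hρ : IsRegularFamily ρ) (hμ₀ : μ₀ ∈ meanSpace ρ)
    (hα : ∀ i, |α i| ≤ 1) (hk : 1 ≤ k) {ε : ℝ} (hε : 0 < ε) (hε1 : ε ≤ 1) :
    ∃ r > 0, ∃ C ≥ 1, ∀ δ ∈ Set.Ioo (-r) r, (∀ i, μ₀ + δ * α i ∈ meanSpace ρ) ∧
      ∀ x, (envelope C (2 * ε) x)⁻¹ ≤ ratioPath ρ μ₀ α 0 δ x ∧
        ∀ j ≤ 3, |ratioPath ρ μ₀ α j δ x| ≤ envelope C (2 * ε) x := by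
  obtain ⟨r, hr, K, hK, hbound⟩ := hρ.exists_bounds hμ₀ hε
  have hk' : (1 : ℝ) ≤ k := by exact_mod_cast hk
  -- Chosen so that `5 (K y)³ = D · (ε y)³ / 6`, to be combined with `(ε y)³ / 6 ≤ exp (ε y)`.
  set D : ℝ := 30 * K ^ 3 / ε ^ 3 with hD
  have hD1 : 1 ≤ D := by
    rw [hD, one_le_div (by positivity)]
    have h1 : ε ^ 3 ≤ 1 := pow_le_one₀ hε.le hε1
    have h2 : 1 ≤ K ^ 3 := one_le_pow₀ hK
    linarith
  -- The log-density bounds involve `∑ |x_i| + k`; the extra `k` goes into the constant.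
  refine ⟨r, hr, D * Real.exp (2 * ε * k), ?_, fun δ hδ => ?_⟩
  · have : 1 ≤ Real.exp (2 * ε * k) := Real.one_le_exp (by positivity)
    nlinarith
  have hnear : ∀ i, |μ₀ + δ * α i - μ₀| < r := fun i => by
    rw [add_sub_cancel_left, abs_mul]
    calc |δ| * |α i| ≤ |δ| * 1 := by gcongr; exact hα i
      _ < r := by rw [mul_one]; exact abs_lt.2 hδ
  have hb := fun i => hbound _ (hnear i)
  refine ⟨fun i => (hb i).1, fun x => ?_⟩
  have hy : 0 < absSum x + k := by linarith [absSum_nonneg x]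
  have henv : envelope (D * Real.exp (2 * ε * k)) (2 * ε) x
      = D * Real.exp (2 * ε * (absSum x + k)) := by
    rw [envelope, mul_assoc, ← Real.exp_add]
    ring_nf
  have hexp : |logPath ρ μ₀ α 0 δ x - logPath ρ μ₀ α 0 0 x| ≤ ε * (absSum x + k) := by
    have := abs_sum_mul_sub_le (fun i => (hb i).2.1) (fun i => (hb i).2.2.1) x
    convert this using 2
    simp only [logPath, iteratedDeriv_zero, pow_zero, one_mul, zero_mul, add_zero,
      ← Finset.sum_sub_distrib]
    exact Finset.sum_congr rfl fun i _ => by ring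
  have hT : 1 ≤ K * (absSum x + k) := by nlinarith [absSum_nonneg x]
  have hlog : ∀ j, 1 ≤ j → j ≤ 3 → |logPath ρ μ₀ α j δ x| ≤ K * (absSum x + k) := by
    intro j _ hj
    have hpow : ∀ i, |α i ^ j| ≤ 1 := fun i => by
      rw [abs_pow]; exact pow_le_one₀ (abs_nonneg _) (hα i)
    have hmul : ∀ i c, |c| ≤ K → |α i ^ j * c| ≤ K := fun i c hc => by
      rw [abs_mul]
      calc |α i ^ j| * |c| ≤ 1 * K := by gcongr; exact hpow i
        _ = K := one_mul K
    have := abs_sum_mul_sub_le (fun i => hmul i _ ((hb i).2.2.2 j hj).1)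
      (fun i => hmul i _ ((hb i).2.2.2 j hj).2) x
    convert this using 2
    exact Finset.sum_congr rfl fun i _ => by ring
  rw [henv]
  constructor
  · rw [ratioPath, bellPoly, one_mul]
    rw [inv_le_comm₀ (by positivity) (Real.exp_pos _), ← Real.exp_neg]
    have h1 : Real.exp (-(logPath ρ μ₀ α 0 δ x - logPath ρ μ₀ α 0 0 x))
        ≤ Real.exp (2 * ε * (absSum x + k)) := by
      rw [Real.exp_le_exp]
      have := (abs_le.1 hexp).1
      have : 0 < ε * (absSum x + k) := by positivity
      linarith
    exact h1.trans (le_mul_of_one_le_left (Real.exp_pos _).le hD1)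
  · intro j hj
    have hbell := abs_bellPoly_le hT hlog hj
    have hcube : (ε * (absSum x + k)) ^ 3 / 6 ≤ Real.exp (ε * (absSum x + k)) := by
      simpa [Nat.factorial] using Real.pow_div_factorial_le_exp _ (by positivity) 3
    have hle : Real.exp (logPath ρ μ₀ α 0 δ x - logPath ρ μ₀ α 0 0 x)
        ≤ Real.exp (ε * (absSum x + k)) := Real.exp_le_exp.2 ((le_abs_self _).trans hexp)
    rw [ratioPath, abs_mul, Real.abs_exp]
    calc |bellPoly (logPath ρ μ₀ α · δ x) j|
          * Real.exp (logPath ρ μ₀ α 0 δ x - logPath ρ μ₀ α 0 0 x)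
        ≤ 5 * (K * (absSum x + k)) ^ 3 * Real.exp (ε * (absSum x + k)) := by gcongr
      _ = D * ((ε * (absSum x + k)) ^ 3 / 6) * Real.exp (ε * (absSum x + k)) := by
        rw [hD]; field_simp; ring
      _ ≤ D * Real.exp (ε * (absSum x + k)) * Real.exp (ε * (absSum x + k)) := by gcongr
      _ = D * Real.exp (2 * ε * (absSum x + k)) := by
        rw [mul_assoc, ← Real.exp_add]; ring_nf

lemma integrable_jointDensity_mul_envelope {t : ℝ}
    (ht : Integrable (fun x => density ρ μ₀ x * Real.exp (t * |x|)) ρ) (C : ℝ) :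
    Integrable (fun x => jointDensity ρ (rep k μ₀) x * envelope C t x)
      (Measure.pi fun _ => ρ) := by
  have := (Integrable.fintype_prod (ι := Fin k) (μ := fun _ => ρ) fun _ => ht).const_mul C
  refine this.congr (ae_of_all _ fun x => ?_)
  simp only [jointDensity, rep, envelope, absSum, Finset.prod_mul_distrib, ← Real.exp_sum,
    Finset.mul_sum]
  ring

lemma envelope_pow (C t : ℝ) (n : ℕ) (x : Fin k → ℝ) :
    envelope C t x ^ n = envelope (C ^ n) (n * t) x := by
  rw [envelope, envelope, mul_pow, ← Real.exp_nat_mul, mul_assoc]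

end Path

/-! ### The path of densities of the sum -/

section SumPath

variable {ρ : Measure ℝ} [IsProbabilityMeasure ρ] {k : ℕ} {μ₀ : ℝ} {α : Fin k → ℝ}

/-- The `j`-th derivative in `δ` of `g_z(δ) / g_z(0)`, for `j ≤ 3`. -/
noncomputable def sumPath (ρ : Measure ℝ) [IsProbabilityMeasure ρ] (μ₀ : ℝ) (α : Fin k → ℝ)
    (j : ℕ) (δ z : ℝ) : ℝ :=
  ∫ x, ratioPath ρ μ₀ α j δ x ∂(fiber ρ k z)

/-- The integral of the envelope over the fiber `Z = z`. -/
noncomputable def sumEnvelope (ρ : Measure ℝ) [IsProbabilityMeasure ρ] (k : ℕ) (C t z : ℝ) : ℝ :=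
  ∫ x, envelope C t x ∂(fiber ρ k z)

/-- The density of `Z` under `P_⟨m⟩` relative to the law of `Z` under `ρ^k`, in closed form. -/
noncomputable def repDensity (ρ : Measure ℝ) (k : ℕ) (m z : ℝ) : ℝ :=
  Real.exp (canonicalParam ρ m * z - k * meanLogNormalizer ρ m)

variable {z : ℝ}

lemma jointDensity_rep_ae_eq (hz : ∀ᵐ x ∂(fiber ρ k z), sumStat x = z) (m : ℝ) :
    ∀ᵐ x ∂(fiber ρ k z), jointDensity ρ (rep k m) x = repDensity ρ k m z := by
  filter_upwards [hz] with x hx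
  rw [jointDensity_rep, hx, repDensity]

/-- On a fiber the density of `P_⟨m⟩` is constant, so it factors out of the integral. This is what
makes `g_z(δ) / g_z(0)` a fiber average of density ratios. -/
lemma integral_jointDensity_rep_mul (hz : ∀ᵐ x ∂(fiber ρ k z), sumStat x = z) (m : ℝ)
    (φ : (Fin k → ℝ) → ℝ) :
    ∫ x, jointDensity ρ (rep k m) x * φ x ∂(fiber ρ k z)
      = repDensity ρ k m z * ∫ x, φ x ∂(fiber ρ k z) := by
  rw [← integral_const_mul]
  refine integral_congr_ae ?_
  filter_upwards [jointDensity_rep_ae_eq hz m] with x hx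
  rw [hx]

lemma integrable_jointDensity_rep_mul_iff (hz : ∀ᵐ x ∂(fiber ρ k z), sumStat x = z) (m : ℝ)
    (φ : (Fin k → ℝ) → ℝ) :
    Integrable (fun x => jointDensity ρ (rep k m) x * φ x) (fiber ρ k z)
      ↔ Integrable φ (fiber ρ k z) := by
  rw [← integrable_const_mul_iff (c := repDensity ρ k m z) (Real.exp_pos _).ne'.isUnit φ]
  refine integrable_congr ?_
  filter_upwards [jointDensity_rep_ae_eq hz m] with x hx
  rw [hx]

lemma sumDensity_rep (hz : ∀ᵐ x ∂(fiber ρ k z), sumStat x = z) (m : ℝ) :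
    sumDensity ρ (rep k m) z = repDensity ρ k m z := by
  simpa [sumDensity] using integral_jointDensity_rep_mul hz m fun _ => 1

lemma g_eq_mul_sumPath (hz : ∀ᵐ x ∂(fiber ρ k z), sumStat x = z) :
    g ρ μ₀ α z = fun δ => repDensity ρ k μ₀ z * sumPath ρ μ₀ α 0 δ z := by
  ext δ
  simp_rw [g, sumDensity, jointDensity_shifted_eq_mul]
  exact integral_jointDensity_rep_mul hz μ₀ _

lemma sumPath_zero_zero : sumPath ρ μ₀ α 0 0 z = 1 := by
  simp [sumPath, ratioPath_zero_zero]

section Envelope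

variable {C t r : ℝ}

lemma one_le_sumEnvelope (hC : 1 ≤ C) (ht : 0 ≤ t)
    (hW : Integrable (envelope (k := k) C t) (fiber ρ k z)) : 1 ≤ sumEnvelope ρ k C t z := by
  have := integral_mono (integrable_const (1 : ℝ)) hW fun x => one_le_envelope hC ht x
  simpa [sumEnvelope] using this

lemma abs_sumPath_le {j : ℕ} {δ : ℝ} (hW : Integrable (envelope (k := k) C t) (fiber ρ k z))
    (hj : ∀ x, |ratioPath ρ μ₀ α j δ x| ≤ envelope C t x) :
    |sumPath ρ μ₀ α j δ z| ≤ sumEnvelope ρ k C t z := by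
  unfold sumPath sumEnvelope
  exact norm_integral_le_of_norm_le (f := ratioPath ρ μ₀ α j δ) hW (ae_of_all _ hj)

/-- Jensen's inequality for the reciprocal, on a fiber. -/
lemma inv_sumEnvelope_le {δ : ℝ} (hC : 1 ≤ C) (ht : 0 ≤ t)
    (hW : Integrable (envelope (k := k) C t) (fiber ρ k z))
    (hle : ∀ x, |ratioPath ρ μ₀ α 0 δ x| ≤ envelope C t x)
    (hlow : ∀ x, (envelope C t x)⁻¹ ≤ ratioPath ρ μ₀ α 0 δ x) :
    (sumEnvelope ρ k C t z)⁻¹ ≤ sumPath ρ μ₀ α 0 δ z := by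
  set V := sumEnvelope ρ k C t z with hV
  have hV0 : 0 < V := one_pos.trans_le (one_le_sumEnvelope hC ht hW)
  have hint : Integrable (ratioPath ρ μ₀ α 0 δ) (fiber ρ k z) :=
    hW.mono' (measurable_ratioPath (by lia) δ).aestronglyMeasurable (ae_of_all _ hle)
  have hlin : Integrable (fun x => 2 * V⁻¹ - V⁻¹ ^ 2 * envelope C t x) (fiber ρ k z) :=
    (integrable_const _).sub (hW.const_mul _)
  -- The left side is the tangent line to `w ↦ 1/w` at `w = V`; as `V` is the mean of the envelope,
  -- its integral is `1/V`.
  have hpt : ∀ x, 2 * V⁻¹ - V⁻¹ ^ 2 * envelope C t x ≤ ratioPath ρ μ₀ α 0 δ x := by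
    intro x
    refine le_trans ?_ (hlow x)
    have hE : 0 < envelope C t x := one_pos.trans_le (one_le_envelope hC ht x)
    have : (envelope C t x)⁻¹ - (2 * V⁻¹ - V⁻¹ ^ 2 * envelope C t x)
        = envelope C t x * ((envelope C t x)⁻¹ - V⁻¹) ^ 2 := by
      field_simp
      ring
    have : 0 ≤ envelope C t x * ((envelope C t x)⁻¹ - V⁻¹) ^ 2 := by positivity
    linarith
  have h := integral_mono hlin hint hpt
  rw [integral_sub (integrable_const _) (hW.const_mul _),
    integral_const_mul (V⁻¹ ^ 2)] at h
  have hVe : ∫ x, envelope C t x ∂(fiber ρ k z) = V := rfl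
  rw [hVe] at h
  simp only [integral_const, probReal_univ, one_smul] at h
  refine le_trans (le_of_eq ?_) h
  field_simp
  ring

lemma sumEnvelope_pow_le (hC : 1 ≤ C) (ht : 0 ≤ t) (n : ℕ)
    (hW : Integrable (envelope (k := k) C t) (fiber ρ k z))
    (hWn : Integrable (envelope (k := k) (C ^ n) (n * t)) (fiber ρ k z)) :
    sumEnvelope ρ k C t z ^ n ≤ sumEnvelope ρ k (C ^ n) (n * t) z := by
  have := (convexOn_pow n).map_integral_le (μ := fiber ρ k z) (f := envelope C t)
    (continuousOn_pow n) isClosed_Ici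
    (ae_of_all _ fun x => zero_le_one.trans (one_le_envelope hC ht x)) hW
    (by simpa [Function.comp_def, envelope_pow] using hWn)
  simpa [envelope_pow, sumEnvelope] using this

lemma ae_integrable_envelope
    (ht : Integrable (fun x => density ρ μ₀ x * Real.exp (t * |x|)) ρ) (C : ℝ) :
    ∀ᵐ z ∂(sumBase ρ k), Integrable (envelope (k := k) C t) (fiber ρ k z) := by
  filter_upwards [ae_fiber_sumStat_eq ρ k,
    ae_integrable_fiber (integrable_jointDensity_mul_envelope (k := k) ht C)] with z h1 h2
  exact (integrable_jointDensity_rep_mul_iff h1 μ₀ _).1 h2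

/-- By Jensen the power moves inside the fiber integral and multiplies the rate `t` by `n`. The
density of `Z`, constant on the fiber, moves inside as well, leaving an exponential moment under
`P_⟨μ₀⟩`. -/
lemma integrable_sumEnvelope_pow (hμ₀ : μ₀ ∈ meanSpace ρ) (hC : 1 ≤ C) (ht0 : 0 ≤ t) (n : ℕ)
    (ht : Integrable (fun x => density ρ μ₀ x * Real.exp (t * |x|)) ρ)
    (hnt : Integrable (fun x => density ρ μ₀ x * Real.exp (n * t * |x|)) ρ) :
    Integrable (fun z => sumEnvelope ρ k C t z ^ n) (sumLaw ρ (rep k μ₀)) := by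
  rw [sumLaw_eq_withDensity (μ := rep k μ₀) fun _ => hμ₀,
    integrable_withDensity_iff_integrable_smul' (measurable_sumDensity _).ennreal_ofReal
      (ae_of_all _ fun _ => ENNReal.ofReal_lt_top)]
  refine (integrable_integral_fiber
    (integrable_jointDensity_mul_envelope (k := k) hnt (C ^ n))).mono' ?_ ?_
  · have h1 := measurable_sumDensity (ρ := ρ) (rep k μ₀)
    have h2 : Measurable (sumEnvelope ρ k C t) := measurable_integral_fiber (by fun_prop)
    exact (h1.ennreal_ofReal.ennreal_toReal.smul (h2.pow_const n)).aestronglyMeasurable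
  · filter_upwards [ae_fiber_sumStat_eq ρ k, ae_integrable_envelope (k := k) ht C,
      ae_integrable_envelope (k := k) hnt (C ^ n)] with z h1 h2 h3
    have hpos : 0 < repDensity ρ k μ₀ z := Real.exp_pos _
    have hV := one_le_sumEnvelope hC ht0 h2
    rw [sumDensity_rep h1, ENNReal.toReal_ofReal hpos.le, smul_eq_mul,
      integral_jointDensity_rep_mul h1, Real.norm_eq_abs,
      abs_of_nonneg (mul_nonneg hpos.le (by positivity))]
    exact mul_le_mul_of_nonneg_left (sumEnvelope_pow_le hC ht0 n h2 h3) hpos.le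

lemma hasDerivAt_sumPath (hρ : IsRegularFamily ρ)
    (hW : Integrable (envelope (k := k) C t) (fiber ρ k z))
    (hM : ∀ δ ∈ Set.Ioo (-r) r, ∀ i, μ₀ + δ * α i ∈ meanSpace ρ)
    (hle : ∀ δ ∈ Set.Ioo (-r) r, ∀ x, ∀ j ≤ 3, |ratioPath ρ μ₀ α j δ x| ≤ envelope C t x)
    {j : ℕ} (hj : j < 3) {δ : ℝ} (hδ : δ ∈ Set.Ioo (-r) r) :
    HasDerivAt (sumPath ρ μ₀ α j · z) (sumPath ρ μ₀ α (j + 1) δ z) δ :=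
  hasDerivAt_integral_chain (F := ratioPath ρ μ₀ α) isOpen_Ioo
    (fun _ hj δ _ => (measurable_ratioPath hj δ).aestronglyMeasurable)
    (ae_of_all _ fun x j hj δ hδ => hle δ hδ x j hj) hW
    (ae_of_all _ fun x _ hj δ hδ => hρ.hasDerivAt_ratioPath (hM δ hδ) hj x) hj hδ

lemma continuousOn_sumPath (hρ : IsRegularFamily ρ)
    (hW : Integrable (envelope (k := k) C t) (fiber ρ k z))
    (hM : ∀ δ ∈ Set.Ioo (-r) r, ∀ i, μ₀ + δ * α i ∈ meanSpace ρ)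
    (hle : ∀ δ ∈ Set.Ioo (-r) r, ∀ x, ∀ j ≤ 3, |ratioPath ρ μ₀ α j δ x| ≤ envelope C t x) :
    ContinuousOn (sumPath ρ μ₀ α 3 · z) (Set.Ioo (-r) r) :=
  continuousOn_integral_chain (F := ratioPath ρ μ₀ α)
    (fun _ hj δ _ => (measurable_ratioPath hj δ).aestronglyMeasurable)
    (ae_of_all _ fun x j hj δ hδ => hle δ hδ x j hj) hW
    (ae_of_all _ fun x δ hδ => (hρ.continuousAt_ratioPath (hM δ hδ) x).continuousWithinAt)

end Envelope

lemma IsRegularFamily.integrable_id (hρ : IsRegularFamily ρ) : Integrable id ρ :=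
  integrable_of_mem_interior_integrableExpSet
    (hρ.mem_interior (by simp [canonicalSpace, integrableExpSet]))

/-- In a direction whose entries sum to `0`, the densities of `Z` have vanishing derivative. -/
lemma IsRegularFamily.ae_sumPath_one_zero (hρ : IsRegularFamily ρ) (hμ₀ : μ₀ ∈ meanSpace ρ)
    (hα : ∑ i, α i = 0) : ∀ᵐ z ∂(sumBase ρ k), sumPath ρ μ₀ α 1 0 z = 0 := by
  have hev (i : Fin k) : Integrable (fun x : Fin k → ℝ => x i) (Measure.pi fun _ => ρ) :=
    integrable_comp_eval (X := fun _ : Fin k => ℝ) (f := fun y : ℝ => y) hρ.integrable_id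
  have h1 : ∀ᵐ z ∂(sumBase ρ k), ∀ i, Integrable (fun x : Fin k → ℝ => x i) (fiber ρ k z) :=
    ae_all_iff.2 fun i => ae_integrable_fiber (hev i)
  have h2 : ∀ᵐ z ∂(sumBase ρ k), ∀ i j,
      ∫ x : Fin k → ℝ, x i ∂(fiber ρ k z) = ∫ x, x j ∂(fiber ρ k z) :=
    ae_all_iff.2 fun i => ae_all_iff.2 fun j => ae_integral_fiber_eval_eq k hρ.integrable_id i j
  filter_upwards [h1, h2] with z hz1 hz2
  simp_rw [sumPath, hρ.ratioPath_one_zero hμ₀]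
  have hint (i : Fin k) : Integrable (fun x : Fin k → ℝ => α i * (x i - μ₀)) (fiber ρ k z) :=
    ((hz1 i).sub (integrable_const _)).const_mul _
  rw [integral_const_mul, integral_finsetSum _ fun i _ => hint i]
  have hterm (i : Fin k) : ∫ x : Fin k → ℝ, α i * (x i - μ₀) ∂(fiber ρ k z)
      = α i * (∫ x : Fin k → ℝ, x i ∂(fiber ρ k z) - μ₀) := by
    rw [integral_const_mul, integral_sub (hz1 i) (integrable_const _)]
    simp
  simp_rw [hterm]
  rcases isEmpty_or_nonempty (Fin k) with _ | ⟨⟨i₀⟩⟩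
  · simp
  -- With one common conditional mean, the sum is `(∑ α i)` times a constant.
  · simp_rw [fun i => hz2 i i₀]
    rw [← Finset.sum_mul, hα, zero_mul, mul_zero]

/-- The densities of `Z` along a direction form a dominated path of ratios, and all of their
derivatives may be computed under the integral over the fiber. -/
lemma IsRegularFamily.exists_dominatedPath (hρ : IsRegularFamily ρ) (hμ₀ : μ₀ ∈ meanSpace ρ)
    (hα : α ∈ directions k) :
    ∃ r C t : ℝ, 0 < r ∧
      (∀ δ ∈ Set.Ioo (-r) r, ∀ i, μ₀ + δ * α i ∈ meanSpace ρ) ∧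
      (∀ᵐ z ∂(sumBase ρ k), Integrable (envelope (k := k) C t) (fiber ρ k z)) ∧
      (∀ δ ∈ Set.Ioo (-r) r, ∀ x, ∀ j ≤ 3, |ratioPath ρ μ₀ α j δ x| ≤ envelope C t x) ∧
      DominatedPath (sumLaw ρ (rep k μ₀)) r (sumPath ρ μ₀ α) (sumEnvelope ρ k C t) := by
  obtain ⟨hα1, hα0⟩ := hα
  have hsq : ∑ j, α j ^ 2 = 1 := by rwa [Real.sqrt_eq_one] at hα1
  have habs : ∀ i, |α i| ≤ 1 := fun i => by
    rw [← sq_le_one_iff_abs_le_one, ← hsq]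
    exact Finset.single_le_sum (f := fun i => α i ^ 2) (fun i _ => sq_nonneg _)
      (Finset.mem_univ i)
  have hk : 1 ≤ k := by
    rcases Nat.eq_zero_or_pos k with rfl | h
    · simp at hsq
    · exact h
  obtain ⟨s, hs, hint⟩ := hρ.exists_integrable_density_mul_exp hμ₀
  -- The fifth power of the envelope has rate `5 · 2 ε ≤ s / 2`, safely below `s`.
  set ε : ℝ := min 1 (s / 20) with hε
  have hε0 : 0 < ε := by positivity
  have hεs : ε ≤ s / 20 := min_le_right _ _
  obtain ⟨r, hr, C, hC, henv⟩ := hρ.exists_envelope hμ₀ habs hk hε0 (min_le_left _ _)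
  have ht0 : 0 ≤ 2 * ε := by positivity
  have ht : Integrable (fun x => density ρ μ₀ x * Real.exp (2 * ε * |x|)) ρ :=
    hint _ (by rw [abs_of_nonneg ht0]; linarith)
  have h5t : Integrable (fun x => density ρ μ₀ x * Real.exp ((5 : ℕ) * (2 * ε) * |x|)) ρ :=
    hint _ (by rw [abs_of_nonneg (by positivity)]; push_cast; linarith)
  have hM : ∀ δ ∈ Set.Ioo (-r) r, ∀ i, μ₀ + δ * α i ∈ meanSpace ρ := fun δ hδ => (henv δ hδ).1
  have hle : ∀ δ ∈ Set.Ioo (-r) r, ∀ x, ∀ j ≤ 3,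
      |ratioPath ρ μ₀ α j δ x| ≤ envelope C (2 * ε) x := fun δ hδ x => ((henv δ hδ).2 x).2
  -- The envelope does not depend on `δ`, so one null set of `z` serves all `δ` near `0` at once.
  have hW := ae_integrable_envelope (k := k) ht C
  have hac : sumLaw ρ (rep k μ₀) ≪ sumBase ρ k := by
    rw [sumLaw_eq_withDensity (μ := rep k μ₀) fun _ => hμ₀]
    exact withDensity_absolutelyContinuous _ _
  have hWQ := hac.ae_le hW
  refine ⟨r, C, 2 * ε, hr, hM, hW, hle, ?_⟩
  refine
    { pos := hr
      measurable := fun j hj δ _ => measurable_integral_fiber (measurable_ratioPath hj δ)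
      one_le := ?_
      inv_le := ?_
      abs_le := ?_
      integrable := integrable_sumEnvelope_pow hμ₀ hC ht0 5 ht h5t
      hasDerivAt := ?_
      continuousOn := ?_
      zero_eq := ae_of_all _ fun z => sumPath_zero_zero
      one_eq := hac.ae_le (hρ.ae_sumPath_one_zero hμ₀ hα0) }
  · filter_upwards [hWQ] with z hz using one_le_sumEnvelope hC ht0 hz
  · filter_upwards [hWQ] with z hz δ hδ
    exact inv_sumEnvelope_le hC ht0 hz (fun x => hle δ hδ x 0 (by lia))
      fun x => ((henv δ hδ).2 x).1
  · filter_upwards [hWQ] with z hz j hj δ hδ using abs_sumPath_le hz fun x => hle δ hδ x j hj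
  · filter_upwards [hWQ] with z hz j hj δ hδ using hasDerivAt_sumPath hρ hz hM hle hj hδ
  · filter_upwards [hWQ] with z hz using continuousOn_sumPath hρ hz hM hle

lemma average_shifted (hα : α ∈ directions k) (δ : ℝ) :
    (1 / (k : ℝ)) * ∑ i, shifted μ₀ α δ i = μ₀ := by
  have hk : (k : ℝ) ≠ 0 := by
    rintro h
    have : k = 0 := by exact_mod_cast h
    subst this
    simpa using hα.1
  simp only [shifted_apply, Finset.sum_add_distrib, ← Finset.mul_sum, hα.2]
  simp
  field_simp

end SumPath

end ExpFam

theorem theorem3 (ρ : Measure ℝ) [IsProbabilityMeasure ρ] (hρ : IsRegularFamily ρ) (k : ℕ)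
    (μ₀ : ℝ) (hμ₀ : μ₀ ∈ meanSpace ρ) (α : Fin k → ℝ) (hα : α ∈ directions k) :
    -- `g` is the density of `Z`; the expectation is finite and equals the KL divergence
    (∀ δ : ℝ, shifted μ₀ α δ ∈ alternatives ρ k μ₀ →
      sumLaw ρ (shifted μ₀ α δ)
          = (sumBase ρ k).withDensity (fun z => ENNReal.ofReal (g ρ μ₀ α z δ)) ∧
      Integrable (logDiff ρ μ₀ (shifted μ₀ α δ)) (jointLaw ρ (shifted μ₀ α δ)) ∧
      klDiv (sumLaw ρ (shifted μ₀ α δ)) (sumLaw ρ (rep k μ₀)) ≠ ⊤ ∧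
      growthDiff ρ μ₀ α δ
          = (klDiv (sumLaw ρ (shifted μ₀ α δ)) (sumLaw ρ (rep k μ₀))).toReal) ∧
    -- `g_z` is positive and twice differentiable at `0`, `g_z'(0) = 0`, formula for `g_z''(0)`
    DifferentiableAt ℝ (fisherInfo ρ) μ₀ ∧
    (∀ᵐ z ∂(sumBase ρ k),
      0 < g ρ μ₀ α z 0 ∧
      ContDiffAt ℝ 2 (g ρ μ₀ α z) 0 ∧
      deriv (g ρ μ₀ α z) 0 = 0 ∧
      Integrable (secondDerivIntegrand ρ μ₀ α) (fiber ρ k z) ∧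
      iteratedDeriv 2 (g ρ μ₀ α z) 0
          = ∫ x, secondDerivIntegrand ρ μ₀ α x ∂(fiber ρ k z)) ∧
    -- the first three derivatives of the growth rate difference vanish at `0`
    ContDiffAt ℝ 3 (growthDiff ρ μ₀ α) 0 ∧
    (∀ j : ℕ, 1 ≤ j → j ≤ 3 → iteratedDeriv j (growthDiff ρ μ₀ α) 0 = 0) ∧
    -- the fourth-order expansion, with finite coefficient
    Integrable (fun z => (iteratedDeriv 2 (g ρ μ₀ α z) 0) ^ 2 / g ρ μ₀ α z 0) (sumBase ρ k) ∧
    ((fun δ : ℝ => growthDiff ρ μ₀ α δ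
        - (1 / 8) * (∫ z, (iteratedDeriv 2 (g ρ μ₀ α z) 0) ^ 2 / g ρ μ₀ α z 0 ∂(sumBase ρ k))
          * δ ^ 4) =o[𝓝 0] fun δ : ℝ => δ ^ 4) ∧
    (growthDiff ρ μ₀ α =O[𝓝 0] fun δ : ℝ => δ ^ 4) := by
  have hmean := average_shifted (μ₀ := μ₀) hα
  obtain ⟨r, C, t, hr, hM, hW, hle, hpath⟩ := hρ.exists_dominatedPath hμ₀ hα
  have hgood := ae_fiber_sumStat_eq ρ k
  have h0 : (0 : ℝ) ∈ Set.Ioo (-r) r := hpath.zero_mem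
  have hnhds : Set.Ioo (-r) r ∈ 𝓝 (0 : ℝ) := isOpen_Ioo.mem_nhds h0
  have hg2 : ∀ᵐ z ∂(sumBase ρ k), iteratedDeriv 2 (g ρ μ₀ α z) 0
      = repDensity ρ k μ₀ z * sumPath ρ μ₀ α 2 0 z := by
    filter_upwards [hgood, hW] with z hz hzW
    rw [g_eq_mul_sumPath hz]
    exact iteratedDeriv_eqOn_of_hasDerivAt (n := 2)
      (G := fun j δ => repDensity ρ k μ₀ z * sumPath ρ μ₀ α j δ z) isOpen_Ioo
      (fun j hj δ hδ => (hasDerivAt_sumPath hρ hzW hM hle (by lia) hδ).const_mul _) 2 le_rfl 0 h0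
  -- With `p = g_z(0)` and `g_z = p u`, the quotient is `(p u'')² / p = p (u'')²`, and `p` is the
  -- density of `Q` relative to `ρ_[Z]`.
  have hcoef : ∀ᵐ z ∂(sumBase ρ k), iteratedDeriv 2 (g ρ μ₀ α z) 0 ^ 2 / g ρ μ₀ α z 0
      = (ENNReal.ofReal (sumDensity ρ (rep k μ₀) z)).toReal • sumPath ρ μ₀ α 2 0 z ^ 2 := by
    filter_upwards [hgood, hg2] with z hz hz2
    have hpos : 0 < repDensity ρ k μ₀ z := Real.exp_pos _
    rw [hz2, congrFun (g_eq_mul_sumPath hz) 0, sumPath_zero_zero, sumDensity_rep hz,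
      ENNReal.toReal_ofReal hpos.le, smul_eq_mul]
    field_simp
  have hlaw := sumLaw_eq_withDensity (μ := rep k μ₀) fun _ => hμ₀
  have hmeas : Measurable fun z => ENNReal.ofReal (sumDensity ρ (rep k μ₀) z) :=
    (measurable_sumDensity _).ennreal_ofReal
  have hcoef_int : ∫ z, iteratedDeriv 2 (g ρ μ₀ α z) 0 ^ 2 / g ρ μ₀ α z 0 ∂(sumBase ρ k)
      = ∫ z, sumPath ρ μ₀ α 2 0 z ^ 2 ∂(sumLaw ρ (rep k μ₀)) := by
    rw [integral_congr_ae hcoef, hlaw, integral_withDensity_eq_integral_toReal_smul hmeas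
      (ae_of_all _ fun _ => ENNReal.ofReal_lt_top)]
  have hgrowth : growthDiff ρ μ₀ α =ᶠ[𝓝 0]
      fun δ => ∫ z, klFun (sumPath ρ μ₀ α 0 δ z) ∂(sumLaw ρ (rep k μ₀)) := by
    filter_upwards [hnhds] with δ hδ
    have hμ : ∀ i, shifted μ₀ α δ i ∈ meanSpace ρ := hM δ hδ
    rw [growthDiff, integral_logDiff hμ hμ₀ (hmean δ), toReal_klDiv_sumLaw hμ hμ₀]
    refine integral_congr_ae ?_
    have hac : sumLaw ρ (rep k μ₀) ≪ sumBase ρ k := hlaw ▸ withDensity_absolutelyContinuous _ _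
    filter_upwards [hac.ae_le hgood] with z hz
    have hpos : 0 < repDensity ρ k μ₀ z := Real.exp_pos _
    have := congrFun (g_eq_mul_sumPath (μ₀ := μ₀) (α := α) hz) δ
    rw [g] at this
    rw [this, sumDensity_rep hz, mul_div_cancel_left₀ _ hpos.ne']
  have hlittle : (fun δ : ℝ => growthDiff ρ μ₀ α δ
        - (1 / 8) * (∫ z, (iteratedDeriv 2 (g ρ μ₀ α z) 0) ^ 2 / g ρ μ₀ α z 0 ∂(sumBase ρ k))
          * δ ^ 4) =o[𝓝 0] fun δ : ℝ => δ ^ 4 := by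
    rw [hcoef_int]
    refine hpath.integral_klFun_isLittleO.congr' ?_ EventuallyEq.rfl
    filter_upwards [hgrowth] with δ hδ
    rw [hδ]
  refine ⟨fun δ hδ => ?_, hρ.differentiableAt_fisherInfo hμ₀, ?_, ?_, fun j hj1 hj3 => ?_, ?_,
    hlittle, ?_⟩
  · exact ⟨sumLaw_eq_withDensity hδ.1, hρ.integrable_logDiff hδ.1 hμ₀ hδ.2,
      hρ.klDiv_sumLaw_ne_top hδ.1 hμ₀, integral_logDiff hδ.1 hμ₀ hδ.2⟩
  · filter_upwards [hgood, hW, hg2, hρ.ae_sumPath_one_zero hμ₀ hα.2] with z hz hzW hz2 hz1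
    have hpos : 0 < repDensity ρ k μ₀ z := Real.exp_pos _
    have hder : ∀ j < 3, ∀ δ ∈ Set.Ioo (-r) r,
        HasDerivAt (fun δ => repDensity ρ k μ₀ z * sumPath ρ μ₀ α j δ z)
          (repDensity ρ k μ₀ z * sumPath ρ μ₀ α (j + 1) δ z) δ := fun j hj δ hδ =>
      (hasDerivAt_sumPath hρ hzW hM hle hj hδ).const_mul _
    have hsecond : (fun x => jointDensity ρ (rep k μ₀) x * ratioPath ρ μ₀ α 2 0 x)
        = secondDerivIntegrand ρ μ₀ α :=
      funext fun x => hρ.jointDensity_mul_ratioPath_two_zero hμ₀ x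
    refine ⟨?_, ?_, ?_, ?_, ?_⟩
    · simpa [g_eq_mul_sumPath hz, sumPath_zero_zero] using hpos
    · rw [g_eq_mul_sumPath hz]
      exact (contDiffOn_of_hasDerivAt (n := 2)
        (G := fun j δ => repDensity ρ k μ₀ z * sumPath ρ μ₀ α j δ z) isOpen_Ioo
        (fun j hj => hder j (by lia))
        fun δ hδ => (hder 2 (by lia) δ hδ).continuousAt.continuousWithinAt).contDiffAt hnhds
    · rw [g_eq_mul_sumPath hz, (hder 0 (by lia) 0 h0).deriv, zero_add, hz1, mul_zero]
    · rw [← hsecond, integrable_jointDensity_rep_mul_iff hz]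
      exact hzW.mono' (measurable_ratioPath (by lia) 0).aestronglyMeasurable
        (ae_of_all _ fun x => hle 0 h0 x 2 (by lia))
    · rw [hz2, ← hsecond, integral_jointDensity_rep_mul hz, sumPath]
  · exact hpath.contDiffAt_integral_klFun.congr_of_eventuallyEq hgrowth
  · rw [hgrowth.iteratedDeriv_eq j, hpath.iteratedDeriv_integral_klFun hj1 hj3]
  · rw [integrable_congr hcoef, ← integrable_withDensity_iff_integrable_smul' hmeas
      (ae_of_all _ fun _ => ENNReal.ofReal_lt_top), ← hlaw]
    exact hpath.integrable_sq
  · have := hlittle.isBigO.add (isBigO_const_mul_self ((1 / 8) *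
      ∫ z, (iteratedDeriv 2 (g ρ μ₀ α z) 0) ^ 2 / g ρ μ₀ α z 0 ∂(sumBase ρ k))
      (fun δ : ℝ => δ ^ 4) (𝓝 0))
    simpa using this
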